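/- **Definitions.** A relational structure $\mathbb H=\langle H;\theta_1,\dots,\theta_s\rangle$ has a non-empty finite universe $H$ and relations $\theta_i\subseteq H^{r_i}$; the sequence $r_1,\dots,r_s$ is its type. As an input of an algorithm, each relation is given by an explicit listing of its tuples. A CSP instance is a pair $(\mathbb G,\mathbb H)$ of structures of the same type (the type is part of the input), and the question is whether there is a homomorphism from $\mathbb G$ to $\mathbb H$. A polymorphism of $\mathbb H$ is an operation $f:H^k\to H$ ($k\ge 1$) that is a homomorphism from $\mathbb H^k$ to $\mathbb H$; as an input or output of an algorithm it is given by its table of values. A strong linear Maltsev condition $\mathcal M$ is a finite set of linear identities, each of the form $f(x_1,\dots,x_k)\approx g(y_1,\dots,y_n)$ or $f(x_1,\dots,x_k)\approx y$, where $f,g$ are operation symbols from a finite list $f_1,\dots,f_m$ of symbols of fixed arities $\ge 1$, and the $x_i,y_j,y$ are variables (not necessarily distinct). A structure satisfies $\mathcal M$ if it has polymorphisms $f_1,\dots,f_m$ that satisfy all identities of $\mathcal M$. The condition $\mathcal M$ is idempotent if it entails the identity $f(x,\dots,x)\approx x$ for each of its operation symbols $f$ (i.e. all operations, on any set, that satisfy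 $\mathcal M$ are idempotent). * A *uniform polynomial-time algorithm* for $\mathcal M$ is a polynomial-time algorithm that correctly decides each CSP instance $(\mathbb G,\mathbb H)$ such that $\mathbb H$ satisfies $\mathcal M$. * A *semiuniform polynomial-time algorithm* for $\mathcal M$ is a polynomial-time algorithm that, given a CSP instance $(\mathbb G,\mathbb H)$ and polymorphisms $f_1,\dots,f_m$ of $\mathbb H$ that satisfy $\mathcal M$, correctly decides the instance. * The *creation-metaquestion* for $\mathcal M$ is the problem where the input is a structure $\mathbb H$, and the output is a sequence $f_1,\dots,f_m$ of polymorphisms of $\mathbb H$ that satisfy $\mathcal M$ if $\mathbb H$ satisfies $\mathcal M$, and "no" otherwise. **Theorem.** Let $\mathcal M$ be a strong linear Maltsev condition. 1. If the creation-metaquestion for $\mathcal M$ is polynomial-time computable and $\mathcal M$ has a semiuniform polynomial-time algorithm, then $\mathcal M$ has a uniform polynomial-time algorithm. 2. If $\mathcal M$ is idempotent, the converse holds: if $\mathcal M$ has a uniform polynomial-time algorithm, then the creation-metaquestion for $\mathcal M$ is polynomial-time computable and $\mathcal M$ has a semiuniform polynomial-time algorithm. -/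

import Mathlib

namespace CSPMeta

open Function

/-! ### Relational structures, homomorphisms, polymorphisms

A type is the list of the arities of the relations.  A tuple of a relation of arity `r` is
represented by a list of length `r`. -/

/-- A relational structure of type `τ` with universe `A`. -/
structure RelStructure (τ : List ℕ) (A : Type) where
  /-- the relations -/
  rel : Fin τ.length → Set (List A)
  /-- each tuple has the arity of its relation as its length -/
  length_eq : ∀ i, ∀ u ∈ rel i, u.length = τ.get i

variable {τ : List ℕ} {A B : Type}

/-- `f` is a homomorphism: the image of each tuple of a relation of `𝔾` lies in the corresponding
relation of `ℍ`. -/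
def IsHom (𝔾 : RelStructure τ A) (ℍ : RelStructure τ B) (f : A → B) : Prop :=
  ∀ i, ∀ u ∈ 𝔾.rel i, u.map f ∈ ℍ.rel i

/-- The `k`-th power of a structure: a tuple of elements of `A ^ k` is in the relation iff each of
its `k` coordinate projections is in the relation of `ℍ`. -/
def RelStructure.pow (ℍ : RelStructure τ A) (k : ℕ) : RelStructure τ (Fin k → A) where
  rel i := {u | u.length = τ.get i ∧ ∀ j : Fin k, u.map (fun a => a j) ∈ ℍ.rel i}
  length_eq _ _ hu := hu.1

/-- A `k`-ary operation on the universe is a polymorphism if it is a homomorphism from the `k`-th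
power of the structure to the structure. -/
def IsPolymorphism (ℍ : RelStructure τ A) {k : ℕ} (f : (Fin k → A) → A) : Prop :=
  IsHom (ℍ.pow k) ℍ f

/-- A finite relational structure of type `τ`, given explicitly: its universe is
`{0, …, size - 1}`, which is non-empty, and each relation is given by a list of its tuples (in any
order, repetitions being harmless). -/
structure FinStr (τ : List ℕ) where
  /-- the number of elements of the universe -/
  size : ℕ
  /-- the universe is non-empty -/
  size_pos : 0 < size
  /-- for each relation, a list of its tuples -/
  tuples : Fin τ.length → List (List (Fin size))
  /-- each tuple has the arity of its relation as its length -/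
  length_eq : ∀ i, ∀ u ∈ tuples i, u.length = τ.get i

/-- The relational structure that is presented by explicit lists of tuples. -/
def FinStr.toRel (H : FinStr τ) : RelStructure τ (Fin H.size) where
  rel i := {u | u ∈ H.tuples i}
  length_eq := H.length_eq

/-- `(G, H)` is a yes-instance of the CSP: there is a homomorphism from `G` to `H`. -/
def FinStr.HomTo (G H : FinStr τ) : Prop :=
  ∃ f : Fin G.size → Fin H.size, IsHom G.toRel H.toRel f

/-! ### Strong linear Maltsev conditions -/

/-- One side of a linear identity, over operation symbols with arities `ar`: a variable, or an
operation symbol applied to variables.  Variables are natural numbers. -/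
inductive LinTerm {m : ℕ} (ar : Fin m → ℕ) where
  | var (x : ℕ) : LinTerm ar
  | app (f : Fin m) (xs : Fin (ar f) → ℕ) : LinTerm ar

/-- A linear identity `f (x₁, …, x_k) ≈ g (y₁, …, y_n)` or `f (x₁, …, x_k) ≈ y`. -/
structure LinIdentity {m : ℕ} (ar : Fin m → ℕ) where
  /-- the operation symbol of the left-hand side -/
  sym : Fin m
  /-- the variables of the left-hand side -/
  args : Fin (ar sym) → ℕ
  /-- the right-hand side -/
  rhs : LinTerm ar

/-- An interpretation of the operation symbols by operations on `A`. -/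
abbrev Ops {m : ℕ} (ar : Fin m → ℕ) (A : Type) : Type :=
  (i : Fin m) → (Fin (ar i) → A) → A

/-- The value of one side of an identity under an assignment `v` of the variables. -/
def LinTerm.eval {m : ℕ} {ar : Fin m → ℕ} (F : Ops ar A) (v : ℕ → A) : LinTerm ar → A
  | .var x => v x
  | .app f xs => F f (fun j => v (xs j))

/-- The operations satisfy the identity: both sides agree for every assignment. -/
def LinIdentity.Holds {m : ℕ} {ar : Fin m → ℕ} (e : LinIdentity ar) (F : Ops ar A) : Prop :=
  ∀ v : ℕ → A, F e.sym (fun j => v (e.args j)) = e.rhs.eval F v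

/-- A strong linear Maltsev condition: finitely many linear identities over finitely many operation
symbols, all of arity at least one. -/
structure MaltsevCondition where
  /-- the number of operation symbols -/
  m : ℕ
  /-- the arities of the operation symbols -/
  ar : Fin m → ℕ
  /-- operations have arity at least one -/
  ar_pos : ∀ i, 0 < ar i
  /-- the identities -/
  ids : List (LinIdentity ar)

/-- The operations `F` satisfy the condition. -/
def MaltsevCondition.SatisfiedBy (M : MaltsevCondition) (F : Ops M.ar A) : Prop :=
  ∀ e ∈ M.ids, e.Holds F

/-- The identity `e` is entailed: all operations (on any set) that satisfy the condition
satisfy `e`. -/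
def MaltsevCondition.Entails (M : MaltsevCondition) (e : LinIdentity M.ar) : Prop :=
  ∀ (A : Type) (F : Ops M.ar A), M.SatisfiedBy F → e.Holds F

/-- The condition is idempotent: it entails `f (x, …, x) ≈ x` for each operation symbol `f`. -/
def MaltsevCondition.IsIdempotent (M : MaltsevCondition) : Prop :=
  ∀ f : Fin M.m, M.Entails ⟨f, fun _ => 0, .var 0⟩

/-- The operations are polymorphisms of `H` that satisfy the condition. -/
def MaltsevCondition.PolymorphismsOf (M : MaltsevCondition) (H : FinStr τ)
    (F : Ops M.ar (Fin H.size)) : Prop :=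
  (∀ i, IsPolymorphism H.toRel (F i)) ∧ M.SatisfiedBy F

/-- The structure `H` satisfies the condition. -/
def MaltsevCondition.HoldsIn (M : MaltsevCondition) (H : FinStr τ) : Prop :=
  ∃ F : Ops M.ar (Fin H.size), M.PolymorphismsOf H F

/-! ### Polynomial time

Algorithms are programs of the WHILE language over binary trees.  A program uses finitely many
registers, each of which holds a binary tree.  An assignment is charged one plus the number of
nodes of the tree that it writes, and a test is charged one; so the number of steps and the size
of all the data that occur in a run are both polynomially bounded by the cost, and polynomial cost
is the same as polynomial time on a Turing machine. -/

/-- Programs. -/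
inductive Prog where
  /-- `x := nil` -/
  | setNil (x : ℕ) : Prog
  /-- `x := y` -/
  | copy (x y : ℕ) : Prog
  /-- `x := cons y z` -/
  | cons (x y z : ℕ) : Prog
  /-- `x := head y`, where the head of `nil` is `nil` -/
  | head (x y : ℕ) : Prog
  /-- `x := tail y`, where the tail of `nil` is `nil` -/
  | tail (x y : ℕ) : Prog
  /-- `p; q` -/
  | seq (p q : Prog) : Prog
  /-- if `x` is not `nil` then `p`, else `q` -/
  | ite (x : ℕ) (p q : Prog) : Prog
  /-- while `x` is not `nil` do `p` -/
  | loop (x : ℕ) (p : Prog) : Prog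

/-- The contents of the registers. -/
abbrev Store : Type := ℕ → BinaryTree Unit

open BinaryTree in
/-- `Exec p s s' t`: started on the store `s`, the program `p` halts with the store `s'`, and the
cost of the run is `t`. -/
inductive Exec : Prog → Store → Store → ℕ → Prop
  | setNil (x : ℕ) (s : Store) : Exec (.setNil x) s (update s x nil) 1
  | copy (x y : ℕ) (s : Store) : Exec (.copy x y) s (update s x (s y)) (1 + (s y).numNodes)
  | cons (x y z : ℕ) (s : Store) :
      Exec (.cons x y z) s (update s x (node () (s y) (s z))) (1 + (node () (s y) (s z)).numNodes)
  | head (x y : ℕ) (s : Store) :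
      Exec (.head x y) s (update s x (s y).left) (1 + (s y).left.numNodes)
  | tail (x y : ℕ) (s : Store) :
      Exec (.tail x y) s (update s x (s y).right) (1 + (s y).right.numNodes)
  | seq {p q : Prog} {s₁ s₂ s₃ : Store} {t₁ t₂ : ℕ} (h₁ : Exec p s₁ s₂ t₁)
      (h₂ : Exec q s₂ s₃ t₂) : Exec (.seq p q) s₁ s₃ (t₁ + t₂)
  | ite_true {x : ℕ} {p q : Prog} {s s' : Store} {t : ℕ} (hx : s x ≠ nil)
      (h : Exec p s s' t) : Exec (.ite x p q) s s' (1 + t)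
  | ite_false {x : ℕ} {p q : Prog} {s s' : Store} {t : ℕ} (hx : s x = nil)
      (h : Exec q s s' t) : Exec (.ite x p q) s s' (1 + t)
  | loop_done {x : ℕ} {p : Prog} {s : Store} (hx : s x = nil) : Exec (.loop x p) s s 1
  | loop_step {x : ℕ} {p : Prog} {s₁ s₂ s₃ : Store} {t₁ t₂ : ℕ} (hx : s₁ x ≠ nil)
      (h₁ : Exec p s₁ s₂ t₁) (h₂ : Exec (.loop x p) s₂ s₃ t₂) :
      Exec (.loop x p) s₁ s₃ (1 + t₁ + t₂)

/-- The initial store: the input is in register `0`, the other registers are `nil`. -/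
def initStore (x : BinaryTree Unit) : Store :=
  update (fun _ => BinaryTree.nil) 0 x

/-- The function `f` on binary trees is computed by a polynomial-time algorithm: there are a program
and a polynomial such that on each input the program halts with the output in register `0`, at a
cost that is bounded by the polynomial in the size of the input. -/
def PolyTime (f : BinaryTree Unit → BinaryTree Unit) : Prop :=
  ∃ (p : Prog) (P : Polynomial ℕ), ∀ x : BinaryTree Unit,
    ∃ (s : Store) (t : ℕ), Exec p (initStore x) s t ∧ s 0 = f x ∧ t ≤ P.eval x.numNodes

/-! ### Encodings of inputs and outputs -/

/-- Pairs. -/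
def encPair (a b : BinaryTree Unit) : BinaryTree Unit := .node () a b

/-- Lists. -/
def encList : List (BinaryTree Unit) → BinaryTree Unit
  | [] => .nil
  | a :: l => .node () a (encList l)

/-- Natural numbers, in unary.  They only occur as elements or sizes of explicitly given universes
and as arities. -/
def encNat (n : ℕ) : BinaryTree Unit := encList (List.replicate n .nil)

/-- The answers "no" and "yes" of a decision algorithm. -/
def no : BinaryTree Unit := .nil

/-- The answer "yes". -/
def yes : BinaryTree Unit := .node () .nil .nil

/-- A proper output (as opposed to the answer "no") of an algorithm that produces an object. -/
def found (a : BinaryTree Unit) : BinaryTree Unit := .node () .nil a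

/-- A tuple. -/
def encTuple {n : ℕ} (u : List (Fin n)) : BinaryTree Unit :=
  encList (u.map fun a => encNat a)

/-- A structure: the size of its universe, followed by the list of its relations, each given by its
arity and the list of its tuples. -/
def encStr (H : FinStr τ) : BinaryTree Unit :=
  encPair (encNat H.size)
    (encList (List.ofFn fun i => encPair (encNat (τ.get i)) (encList ((H.tuples i).map encTuple))))

/-- All `k`-tuples over `{0, …, n - 1}`, in lexicographic order. -/
def allTuples (n : ℕ) : (k : ℕ) → List (Fin k → Fin n)
  | 0 => [Fin.elim0]
  | k + 1 => (List.finRange n).flatMap fun a => (allTuples n k).map (Fin.cons a)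

/-- The table of an operation: the list of its values, in lexicographic order of the arguments. -/
def encOp {n k : ℕ} (f : (Fin k → Fin n) → Fin n) : BinaryTree Unit :=
  encList ((allTuples n k).map fun x => encNat (f x))

/-- A sequence of operations. -/
def encOps {m n : ℕ} {ar : Fin m → ℕ} (F : Ops ar (Fin n)) : BinaryTree Unit :=
  encList (List.ofFn fun i => encOp (F i))

/-! ### Uniform and semiuniform algorithms, the creation-metaquestion -/

/-- The output `a` is the correct yes/no answer to the question whether `P`. -/
def IsAnswer (a : BinaryTree Unit) (P : Prop) : Prop :=
  (P → a = yes) ∧ (¬ P → a = no)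

/-- There is a uniform polynomial-time algorithm for the class `C` of structures: a polynomial-time
algorithm that correctly decides each CSP instance `(G, H)` with `H` in `C`. -/
def HasUniformAlgorithmFor (C : (τ : List ℕ) → Set (FinStr τ)) : Prop :=
  ∃ f : BinaryTree Unit → BinaryTree Unit, PolyTime f ∧
    ∀ (τ : List ℕ) (G H : FinStr τ), H ∈ C τ →
      IsAnswer (f (encPair (encStr G) (encStr H))) (G.HomTo H)

/-- There is a uniform polynomial-time algorithm for the condition `M`, that is, for the class of
the structures that satisfy `M`. -/
def HasUniformAlgorithm (M : MaltsevCondition) : Prop :=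
  HasUniformAlgorithmFor fun _ => {H | M.HoldsIn H}

/-- There is a semiuniform polynomial-time algorithm for `M`: given a CSP instance `(G, H)`
and polymorphisms of `H` that satisfy `M`, it correctly decides the instance. -/
def HasSemiuniformAlgorithm (M : MaltsevCondition) : Prop :=
  ∃ f : BinaryTree Unit → BinaryTree Unit, PolyTime f ∧
    ∀ (τ : List ℕ) (G H : FinStr τ) (F : Ops M.ar (Fin H.size)), M.PolymorphismsOf H F →
      IsAnswer (f (encPair (encPair (encStr G) (encStr H)) (encOps F))) (G.HomTo H)

/-- The creation-metaquestion for `M` is polynomial-time computable: there is a polynomial-time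
algorithm that, given a structure `H`, outputs polymorphisms of `H` that satisfy `M` if `H`
satisfies `M`, and outputs "no" otherwise. -/
def CreationMetaquestionPolyTime (M : MaltsevCondition) : Prop :=
  ∃ f : BinaryTree Unit → BinaryTree Unit, PolyTime f ∧
    ∀ (τ : List ℕ) (H : FinStr τ),
      (M.HoldsIn H → ∃ F : Ops M.ar (Fin H.size),
        M.PolymorphismsOf H F ∧ f (encStr H) = found (encOps F)) ∧
      (¬ M.HoldsIn H → f (encStr H) = no)

end CSPMeta

/-!
A uniform algorithm is obtained from the other two by composition: first compute polymorphisms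
of the right-hand structure, then hand them to the semiuniform algorithm.  Conversely a uniform
algorithm is a semiuniform one that ignores the polymorphisms, so the point is to solve the
creation-metaquestion with a uniform algorithm when the condition `M` is idempotent.

Polymorphisms of `H` that satisfy `M` are the solutions of a CSP instance, the indicator instance.
The elements of its left-hand structure (`points`) are the pairs of an operation symbol `i` and an
argument `x`; the value of such a point stands for the value of the operation `i` at `x`.
The relations of `H`, lifted to the points (`liftTuples`), express that the operations are
polymorphisms.  The identities `f (…) ≈ g (…)` are expressed by the equality relation
(`equalPairs`), and the identities `f (…) ≈ y` by pinning a point to a constant (`identityPins`).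
The number of points is polynomial because the arities are fixed by `M`.  The right-hand structure
is `H` together with the equality relation and the singletons of all elements: polymorphisms
preserve equality, and idempotent ones preserve the singletons, so it satisfies `M` whenever `H`
does (`MaltsevCondition.PolymorphismsOf.mkStr_pinned`), and then the uniform algorithm decides the
instance correctly, with any further pins (`extendable_iff`).

The search (`searchPins`) therefore pins one point after the other to a value for which the
algorithm reports that a solution still exists.  If `H` does not satisfy `M`, the answers of the
uniform algorithm mean nothing; so in the end the values are tested against all constraints
(`solves`), and the test alone guarantees that an output is right (`polymorphismsOf_opsOf`).

For the running time, `PolyFun f` says that the function `f` between encoded types is computed by a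
program at polynomial cost.  This notion is closed under composition, pairing and case distinction,
and under folds over lists whose states stay polynomially bounded (`PolyFun.foldl_of_bound`); all
the functions that make up the algorithm are obtained from these.  Since `PolyFun` asks nothing of
a program on trees that are not encodings, no junk data has to be considered inside the algorithm;
at the outside every tree is read as the data of some structure (`treeToRaw`).
-/

namespace CSPMeta

open Function BinaryTree

/-! ### Runs of programs -/

/-- `Runs p s Q B`: started on the store `s`, the program `p` halts at a cost of at most `B` in a
store that satisfies `Q`. -/
def Runs (p : Prog) (s : Store) (Q : Store → Prop) (B : ℕ) : Prop :=
  ∃ s' t, Exec p s s' t ∧ t ≤ B ∧ Q s'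

namespace Runs

variable {p q : Prog} {s : Store} {Q R : Store → Prop} {B C : ℕ} {x y z : ℕ}

theorem mono (h : Runs p s Q B) (hQ : ∀ s', Q s' → R s') (hB : B ≤ C) : Runs p s R C := by
  obtain ⟨s', t, he, ht, hq⟩ := h
  exact ⟨s', t, he, ht.trans hB, hQ _ hq⟩

theorem seq (h : Runs p s (fun s' => Runs q s' Q C) B) : Runs (.seq p q) s Q (B + C) := by
  obtain ⟨s₁, t₁, he₁, ht₁, s₂, t₂, he₂, ht₂, hq⟩ := h
  exact ⟨s₂, _, .seq he₁ he₂, Nat.add_le_add ht₁ ht₂, hq⟩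

theorem setNil (h : Q (update s x nil)) : Runs (.setNil x) s Q 1 :=
  ⟨_, _, .setNil x s, le_rfl, h⟩

theorem copy (h : Q (update s x (s y))) (hB : (s y).numNodes ≤ B) :
    Runs (.copy x y) s Q (1 + B) :=
  ⟨_, _, .copy x y s, by omega, h⟩

theorem cons (h : Q (update s x (node () (s y) (s z))))
    (hB : (s y).numNodes + (s z).numNodes ≤ B) : Runs (.cons x y z) s Q (2 + B) :=
  ⟨_, _, .cons x y z s, by simp only [numNodes]; omega, h⟩

theorem head (h : Q (update s x (s y).left)) (hB : (s y).left.numNodes ≤ B) :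
    Runs (.head x y) s Q (1 + B) :=
  ⟨_, _, .head x y s, by omega, h⟩

theorem tail (h : Q (update s x (s y).right)) (hB : (s y).right.numNodes ≤ B) :
    Runs (.tail x y) s Q (1 + B) :=
  ⟨_, _, .tail x y s, by omega, h⟩

theorem ite (h₁ : s x ≠ nil → Runs p s Q B) (h₂ : s x = nil → Runs q s Q B) :
    Runs (.ite x p q) s Q (1 + B) := by
  by_cases hx : s x = nil
  · obtain ⟨s', t, he, ht, hq⟩ := h₂ hx
    exact ⟨s', _, .ite_false hx he, by omega, hq⟩
  · obtain ⟨s', t, he, ht, hq⟩ := h₁ hx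
    exact ⟨s', _, .ite_true hx he, by omega, hq⟩

theorem loop_done (hx : s x = nil) (h : Q s) : Runs (.loop x p) s Q 1 :=
  ⟨s, _, .loop_done hx, le_rfl, h⟩

theorem loop_step (hx : s x ≠ nil) (h : Runs p s (fun s' => Runs (.loop x p) s' Q C) B) :
    Runs (.loop x p) s Q (1 + B + C) := by
  obtain ⟨s₁, t₁, he₁, ht₁, s₂, t₂, he₂, ht₂, hq⟩ := h
  exact ⟨s₂, _, .loop_step hx he₁ he₂, by omega, hq⟩

end Runs

/-- Whatever a run writes has been paid for. -/
theorem Exec.numNodes_le {p : Prog} {s s' : Store} {t : ℕ} (h : Exec p s s' t) (x : ℕ) :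
    (s' x).numNodes ≤ (s x).numNodes + t := by
  induction h with
  | seq _ _ ih₁ ih₂ => omega
  | ite_true _ _ ih => omega
  | ite_false _ _ ih => omega
  | loop_done => omega
  | loop_step _ _ _ ih₁ ih₂ => omega
  | _ =>
    rw [update_apply]
    split_ifs
    · try simp only [numNodes]
      omega
    · omega

/-- A strict upper bound for the registers that a program mentions. -/
def Prog.width : Prog → ℕ
  | .setNil x => x + 1
  | .copy x y => max (x + 1) (y + 1)
  | .cons x y z => max (x + 1) (max (y + 1) (z + 1))
  | .head x y => max (x + 1) (y + 1)
  | .tail x y => max (x + 1) (y + 1)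
  | .seq p q => max p.width q.width
  | .ite x p q => max (x + 1) (max p.width q.width)
  | .loop x p => max (x + 1) p.width

theorem update_agree {s σ : Store} {K : ℕ} (h : ∀ i < K, σ i = s i) (x : ℕ)
    {v w : BinaryTree Unit} (hvw : w = v) : ∀ i < K, update σ x w i = update s x v i := by
  intro i hi
  simp only [update_apply, hvw]
  split_ifs
  · rfl
  · exact h i hi

theorem update_frame {σ : Store} {K x : ℕ} (hx : x < K) (w : BinaryTree Unit) :
    ∀ i, K ≤ i → update σ x w i = σ i := by
  intro i hi
  rw [update_of_ne (by omega)]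

/-- The run of a program neither reads nor changes the registers that it does not mention. -/
theorem Exec.agree {p : Prog} {s s' : Store} {t : ℕ} (h : Exec p s s' t) {K : ℕ}
    (hK : p.width ≤ K) {σ : Store} (hσ : ∀ i < K, σ i = s i) :
    ∃ σ', Exec p σ σ' t ∧ (∀ i < K, σ' i = s' i) ∧ ∀ i, K ≤ i → σ' i = σ i := by
  induction h generalizing σ with
  | setNil x s =>
    simp only [Prog.width] at hK
    exact ⟨_, .setNil x σ, update_agree hσ x rfl, update_frame (by omega) _⟩
  | copy x y s =>
    simp only [Prog.width] at hK
    have hy := hσ y (by omega)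
    exact ⟨_, by rw [← hy]; exact Exec.copy x y σ, update_agree hσ x hy, update_frame (by omega) _⟩
  | cons x y z s =>
    simp only [Prog.width] at hK
    have hy := hσ y (by omega)
    have hz := hσ z (by omega)
    exact ⟨_, by rw [← hy, ← hz]; exact Exec.cons x y z σ, update_agree hσ x (by rw [hy, hz]),
      update_frame (by omega) _⟩
  | head x y s =>
    simp only [Prog.width] at hK
    have hy := hσ y (by omega)
    exact ⟨_, by rw [← hy]; exact Exec.head x y σ, update_agree hσ x (by rw [hy]),
      update_frame (by omega) _⟩
  | tail x y s =>
    simp only [Prog.width] at hK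
    have hy := hσ y (by omega)
    exact ⟨_, by rw [← hy]; exact Exec.tail x y σ, update_agree hσ x (by rw [hy]),
      update_frame (by omega) _⟩
  | seq _ _ ih₁ ih₂ =>
    simp only [Prog.width] at hK
    obtain ⟨σ₁, h₁, e₁, f₁⟩ := ih₁ (by omega) hσ
    obtain ⟨σ₂, h₂, e₂, f₂⟩ := ih₂ (by omega) e₁
    exact ⟨σ₂, .seq h₁ h₂, e₂, fun i hi => (f₂ i hi).trans (f₁ i hi)⟩
  | @ite_true x p q s s' t hx _ ih =>
    simp only [Prog.width] at hK
    obtain ⟨σ₁, h₁, e₁, f₁⟩ := ih (by omega) hσ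
    exact ⟨σ₁, .ite_true (by rwa [hσ x (by omega)]) h₁, e₁, f₁⟩
  | @ite_false x p q s s' t hx _ ih =>
    simp only [Prog.width] at hK
    obtain ⟨σ₁, h₁, e₁, f₁⟩ := ih (by omega) hσ
    exact ⟨σ₁, .ite_false (by rwa [hσ x (by omega)]) h₁, e₁, f₁⟩
  | @loop_done x p s hx =>
    simp only [Prog.width] at hK
    exact ⟨σ, .loop_done (by rwa [hσ x (by omega)]), hσ, fun _ _ => rfl⟩
  | @loop_step x p s₁ s₂ s₃ t₁ t₂ hx _ _ ih₁ ih₂ =>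
    have hK' := hK
    simp only [Prog.width] at hK'
    obtain ⟨σ₁, h₁, e₁, f₁⟩ := ih₁ (by omega) hσ
    obtain ⟨σ₂, h₂, e₂, f₂⟩ := ih₂ hK e₁
    exact ⟨σ₂, .loop_step (by rwa [hσ x (by omega)]) h₁ h₂, e₂,
      fun i hi => (f₂ i hi).trans (f₁ i hi)⟩

/-- Clears the registers `1, …, k`, and register `1` also for `k = 0`. -/
def clear : ℕ → Prog
  | 0 => .setNil 1
  | k + 1 => .seq (clear k) (.setNil (k + 1))

theorem runs_clear (k : ℕ) (s : Store) :
    Runs (clear k) s (fun s' => s' 0 = s 0 ∧ (∀ i, 0 < i → i ≤ k → s' i = nil) ∧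
      ∀ i, k < i → 1 < i → s' i = s i) (k + 1) := by
  induction k with
  | zero =>
    refine Runs.setNil ⟨by simp, by omega, fun i _ hi => ?_⟩
    rw [update_of_ne (by omega)]
  | succ k ih =>
    refine Runs.seq (ih.mono ?_ le_rfl)
    rintro s' ⟨h0, h1, h2⟩
    refine Runs.setNil ⟨by simpa using h0, fun i h hi => ?_, fun i hi h => ?_⟩
    · rw [update_apply]
      split_ifs with h'
      · rfl
      · exact h1 i h (by omega)
    · rw [update_of_ne (by omega)]
      exact h2 i (by omega) h

theorem polynomial_eval_mono (P : Polynomial ℕ) {a b : ℕ} (h : a ≤ b) :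
    P.eval a ≤ P.eval b := by
  rw [Polynomial.eval_eq_sum, Polynomial.eval_eq_sum]
  exact Finset.sum_le_sum fun i _ => Nat.mul_le_mul_left _ (Nat.pow_le_pow_left h i)

/-! ### Polynomial-time functions between encoded types -/

/-- A type whose elements are encoded by binary trees.  Injectivity is not asked for; below, a
result of one type is often read as a result of another type with the same encoding. -/
class TreeEnc (α : Type) where
  /-- the encoding -/
  enc : α → BinaryTree Unit

open TreeEnc

instance : TreeEnc (BinaryTree Unit) := ⟨id⟩
instance : TreeEnc Unit := ⟨fun _ => .nil⟩
instance : TreeEnc Bool := ⟨fun b => if b then yes else no⟩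
instance : TreeEnc ℕ := ⟨encNat⟩
instance {α β : Type} [TreeEnc α] [TreeEnc β] : TreeEnc (α × β) :=
  ⟨fun p => encPair (enc p.1) (enc p.2)⟩
instance {α : Type} [TreeEnc α] : TreeEnc (List α) := ⟨fun l => encList (l.map enc)⟩

/-- The size of an object: the number of nodes of its encoding. -/
def sz {α : Type} [TreeEnc α] (a : α) : ℕ := (enc a).numNodes

variable {α β γ δ : Type} [TreeEnc α] [TreeEnc β] [TreeEnc γ] [TreeEnc δ]

/-- The program `p` computes `f` at a cost bounded by `P`, from any contents of the registers other
than `0`, and leaves the registers from `K` on alone.  Nothing is asked of `p` on trees that are not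
encodings. -/
def Computes (p : Prog) (K : ℕ) (P : Polynomial ℕ) (f : α → β) : Prop :=
  ∀ (a : α) (s : Store), s 0 = enc a →
    Runs p s (fun s' => s' 0 = enc (f a) ∧ ∀ i, K ≤ i → s' i = s i) (P.eval (sz a))

/-- `f` is computable in polynomial time. -/
@[fun_prop]
def PolyFun (f : α → β) : Prop :=
  ∃ (p : Prog) (K : ℕ) (P : Polynomial ℕ), 0 < K ∧ Computes p K P f

theorem Computes.mono {p : Prog} {K K' : ℕ} {P : Polynomial ℕ} {f : α → β}
    (h : Computes p K P f) (hK : K ≤ K') : Computes p K' P f := fun a s hs =>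
  (h a s hs).mono (fun _ h' => ⟨h'.1, fun i hi => h'.2 i (hK.trans hi)⟩) le_rfl

theorem Computes.sz_le {p : Prog} {K : ℕ} {P : Polynomial ℕ} {f : α → β}
    (h : Computes p K P f) (a : α) : sz (f a) ≤ sz a + P.eval (sz a) := by
  obtain ⟨s', t, he, ht, h0, -⟩ := h a (fun _ => enc a) rfl
  have := he.numNodes_le 0
  rw [h0] at this
  exact this.trans (Nat.add_le_add_left ht _)

theorem PolyFun.sz_le {f : α → β} (h : PolyFun f) :
    ∃ P : Polynomial ℕ, ∀ a, sz (f a) ≤ P.eval (sz a) := by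
  obtain ⟨p, K, P, -, h⟩ := h
  exact ⟨.X + P, fun a => by simpa using h.sz_le a⟩

/-- Being computable in polynomial time only depends on the encodings of the values, whatever the
type of the values. -/
theorem PolyFun.of_enc_eq {f : α → β} {f' : α → γ} (h : PolyFun f)
    (hf : ∀ a, enc (f a) = enc (f' a)) : PolyFun f' := by
  obtain ⟨p, K, P, hK, h⟩ := h
  exact ⟨p, K, P, hK, fun a s hs => by simpa only [hf] using h a s hs⟩

theorem PolyFun.polyTime {f : BinaryTree Unit → BinaryTree Unit} (h : PolyFun f) :
    PolyTime f := by
  obtain ⟨p, K, P, -, h⟩ := h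
  refine ⟨p, P, fun x => ?_⟩
  obtain ⟨s', t, he, ht, h0, -⟩ := h x (initStore x) (by simp [initStore, enc])
  exact ⟨s', t, he, h0, ht⟩

theorem PolyTime.polyFun {f : BinaryTree Unit → BinaryTree Unit} (h : PolyTime f) :
    PolyFun f := by
  obtain ⟨p, P, h⟩ := h
  -- the scratch registers are cleared first, so that the program sees its initial store
  refine ⟨.seq (clear (p.width + 1)) p, p.width + 2, .C (p.width + 2) + P, by omega,
    fun a s hs => ?_⟩
  rw [Polynomial.eval_add, Polynomial.eval_C]
  refine Runs.seq ((runs_clear _ s).mono ?_ le_rfl)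
  rintro s₁ ⟨h0, h1, h2⟩
  obtain ⟨s', t, he, hs', ht⟩ := h a
  obtain ⟨σ, hσ, e, f⟩ := he.agree (K := p.width + 2) (by omega) (σ := s₁) (by
    intro i hi
    rcases Nat.eq_zero_or_pos i with rfl | hi0
    · rw [h0, hs]; simp [initStore, enc]
    · rw [h1 i hi0 (by omega), initStore, update_of_ne (by omega)])
  refine ⟨σ, t, hσ, ht, ?_, fun i hi => ?_⟩
  · rw [e 0 (by omega), hs']; rfl
  · rw [f i hi, h2 i (by omega) (by omega)]

namespace PolyFun

@[fun_prop]
protected theorem id : PolyFun fun a : α => a :=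
  ⟨.copy 0 0, 1, 1 + .X, one_pos, fun a s hs => by
    simp only [Polynomial.eval_add, Polynomial.eval_one, Polynomial.eval_X]
    exact Runs.copy ⟨by simpa using hs, update_frame one_pos _⟩ (by rw [hs]; rfl)⟩

@[fun_prop]
theorem comp {g : β → γ} {f : α → β} (hg : PolyFun g) (hf : PolyFun f) :
    PolyFun fun a => g (f a) := by
  obtain ⟨p, K, P, hK, hp⟩ := hf
  obtain ⟨q, L, Q, hL, hq⟩ := hg
  refine ⟨.seq p q, max K L, P + Q.comp (.X + P), by omega, fun a s hs => ?_⟩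
  rw [Polynomial.eval_add, Polynomial.eval_comp, Polynomial.eval_add, Polynomial.eval_X]
  refine Runs.seq ((hp a s hs).mono ?_ le_rfl)
  rintro s₁ ⟨h0, h1⟩
  refine (hq _ s₁ h0).mono ?_ (polynomial_eval_mono _ (hp.sz_le a))
  rintro s₂ ⟨h2, h3⟩
  exact ⟨h2, fun i hi => (h3 i (by omega)).trans (h1 i (by omega))⟩

/-- Every constant tree is written by some program.  The registers from `1` to `K - 1` are spared:
they hold the left subtrees that have been written already. -/
theorem exists_constProg (c : BinaryTree Unit) (K : ℕ) (hK : 0 < K) :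
    ∃ (p : Prog) (L B : ℕ), K ≤ L ∧ ∀ s : Store,
      Runs p s (fun s' => s' 0 = c ∧ ∀ i, 0 < i → i < K ∨ L ≤ i → s' i = s i) B := by
  induction c generalizing K with
  | nil =>
    exact ⟨.setNil 0, K, 1, le_rfl, fun s => Runs.setNil
      ⟨by simp, fun i hi _ => by rw [update_of_ne (by omega)]⟩⟩
  | node u l r ihl ihr =>
    obtain ⟨p, L₁, B₁, hL₁, hp⟩ := ihl K hK
    obtain ⟨q, L₂, B₂, hL₂, hq⟩ := ihr (L₁ + 1) (by omega)
    refine ⟨.seq p (.seq (.copy L₁ 0) (.seq q (.cons 0 L₁ 0))), L₂,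
      B₁ + (1 + l.numNodes + (B₂ + (2 + (l.numNodes + r.numNodes)))), by omega, fun s => ?_⟩
    refine Runs.seq ((hp s).mono ?_ le_rfl)
    rintro s₁ ⟨h1, h1'⟩
    refine Runs.seq (Runs.copy ?_ (by rw [h1]))
    refine Runs.seq ((hq _).mono ?_ le_rfl)
    rintro s₂ ⟨h2, h2'⟩
    have hL : s₂ L₁ = l := by
      rw [h2' L₁ (by omega) (by omega), update_self, h1]
    refine Runs.cons ⟨by rw [update_self, hL, h2], fun i hi hi' => ?_⟩ (by rw [hL, h2])
    rw [update_of_ne (by omega), h2' i hi (by omega), update_of_ne (by omega),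
      h1' i hi (by omega)]

@[fun_prop]
theorem const (b : β) : PolyFun fun _ : α => b := by
  obtain ⟨p, L, B, hL, hp⟩ := exists_constProg (enc b) 1 one_pos
  refine ⟨p, L, .C B, by omega, fun a s _ => ?_⟩
  rw [Polynomial.eval_C]
  exact (hp s).mono (fun s' h => ⟨h.1, fun i hi => h.2 i (by omega) (.inr hi)⟩) le_rfl

/-- A function whose encoded value is the left subtree of another one, such as a projection. -/
theorem left {f : α → β} {g : α → γ} (hf : PolyFun f) (h : ∀ a, enc (g a) = (enc (f a)).left) :
    PolyFun g := by
  have : PolyFun (BinaryTree.left : BinaryTree Unit → BinaryTree Unit) :=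
    ⟨.head 0 0, 1, 1 + .X, one_pos, fun a s hs => by
      simp only [Polynomial.eval_add, Polynomial.eval_one, Polynomial.eval_X]
      refine Runs.head ⟨by rw [update_self, hs]; rfl, update_frame one_pos _⟩ ?_
      rw [hs]
      cases a <;> simp [enc, sz]
      omega⟩
  have h2 : PolyFun fun a => enc (f a) := hf.of_enc_eq fun _ => rfl
  exact (this.comp h2).of_enc_eq fun a => (h a).symm

/-- A function whose encoded value is the right subtree of another one, such as the tail of a
list. -/
theorem right {f : α → β} {g : α → γ} (hf : PolyFun f) (h : ∀ a, enc (g a) = (enc (f a)).right) :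
    PolyFun g := by
  have : PolyFun (BinaryTree.right : BinaryTree Unit → BinaryTree Unit) :=
    ⟨.tail 0 0, 1, 1 + .X, one_pos, fun a s hs => by
      simp only [Polynomial.eval_add, Polynomial.eval_one, Polynomial.eval_X]
      refine Runs.tail ⟨by rw [update_self, hs]; rfl, update_frame one_pos _⟩ ?_
      rw [hs]
      cases a <;> simp [enc, sz]
      omega⟩
  have h2 : PolyFun fun a => enc (f a) := hf.of_enc_eq fun _ => rfl
  exact (this.comp h2).of_enc_eq fun a => (h a).symm

/-- A function whose encoded value is put together from two others, such as a pair or a non-empty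
list. -/
theorem node {f : α → β} {g : α → γ} {k : α → δ} (hf : PolyFun f) (hg : PolyFun g)
    (h : ∀ a, enc (k a) = .node () (enc (f a)) (enc (g a))) : PolyFun k := by
  obtain ⟨p, K, P, hK, hp⟩ := hf
  obtain ⟨q, L, Q, hL, hq⟩ := hg
  obtain ⟨M, hM⟩ : ∃ M, M = max K L := ⟨_, rfl⟩
  replace hp := hp.mono (show K ≤ M by omega)
  replace hq := hq.mono (show L ≤ M by omega)
  -- the input is kept in register `M` and the first value in register `M + 1`
  refine ⟨.seq (.copy M 0) (.seq p (.seq (.copy (M + 1) 0) (.seq (.copy 0 M) (.seq q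
    (.cons 0 (M + 1) 0))))), M + 2,
    (1 + .X) + (P + ((1 + (.X + P)) + ((1 + .X) + (Q + (2 + ((.X + P) + (.X + Q))))))),
    by omega, fun a s hs => ?_⟩
  simp only [Polynomial.eval_add, Polynomial.eval_one, Polynomial.eval_X, Polynomial.eval_ofNat]
  refine Runs.seq (Runs.copy ?_ (by rw [hs]; rfl))
  refine Runs.seq ((hp a _ (by rw [update_of_ne (by omega), hs])).mono ?_ le_rfl)
  rintro s₁ ⟨h1, h1'⟩
  refine Runs.seq (Runs.copy ?_ (by rw [h1]; exact hp.sz_le a))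
  have hM1 : update s₁ (M + 1) (s₁ 0) M = enc a := by
    rw [update_of_ne (by omega), h1' M le_rfl, update_self, hs]
  refine Runs.seq (Runs.copy ?_ (by rw [hM1]; rfl))
  refine Runs.seq ((hq a _ (by rw [update_self, hM1])).mono ?_ le_rfl)
  rintro s₂ ⟨h2, h2'⟩
  have hM2 : s₂ (M + 1) = enc (f a) := by
    rw [h2' _ (by omega), update_of_ne (by omega), update_self, h1]
  refine Runs.cons ⟨by rw [update_self, hM2, h2, h], fun i hi => ?_⟩ ?_
  · rw [update_of_ne (by omega), h2' _ (by omega), update_of_ne (by omega),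
      update_of_ne (by omega), h1' _ (by omega), update_of_ne (by omega)]
  · rw [hM2, h2]
    exact Nat.add_le_add (hp.sz_le a) (hq.sz_le a)

@[fun_prop]
theorem fst : PolyFun fun p : α × β => p.1 := PolyFun.id.left fun _ => rfl

@[fun_prop]
theorem snd : PolyFun fun p : α × β => p.2 := PolyFun.id.right fun _ => rfl

@[fun_prop]
theorem prodMk {f : α → β} {g : α → γ} (hf : PolyFun f) (hg : PolyFun g) :
    PolyFun fun a => (f a, g a) := hf.node hg fun _ => rfl

@[fun_prop]
theorem ite {b : α → Bool} {f g : α → β} (hb : PolyFun b) (hf : PolyFun f) (hg : PolyFun g) :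
    PolyFun fun a => if b a then f a else g a := by
  obtain ⟨r, N, R, hN, hr⟩ := hb
  obtain ⟨p, K, P, hK, hp⟩ := hf
  obtain ⟨q, L, Q, hL, hq⟩ := hg
  obtain ⟨M, hM⟩ : ∃ M, M = max N (max K L) := ⟨_, rfl⟩
  replace hr := hr.mono (show N ≤ M by omega)
  replace hp := hp.mono (show K ≤ M by omega)
  replace hq := hq.mono (show L ≤ M by omega)
  -- the input is kept in register `M` and the condition in register `M + 1`
  refine ⟨.seq (.copy M 0) (.seq r (.seq (.copy (M + 1) 0) (.seq (.copy 0 M)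
    (.ite (M + 1) p q)))), M + 2,
    (1 + .X) + (R + ((1 + (.X + R)) + ((1 + .X) + (1 + (P + Q))))),
    by omega, fun a s hs => ?_⟩
  simp only [Polynomial.eval_add, Polynomial.eval_one, Polynomial.eval_X]
  refine Runs.seq (Runs.copy ?_ (by rw [hs]; rfl))
  refine Runs.seq ((hr a _ (by rw [update_of_ne (by omega), hs])).mono ?_ le_rfl)
  rintro s₁ ⟨h1, h1'⟩
  refine Runs.seq (Runs.copy ?_ (by rw [h1]; exact hr.sz_le a))
  have hM1 : update s₁ (M + 1) (s₁ 0) M = enc a := by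
    rw [update_of_ne (by omega), h1' M le_rfl, update_self, hs]
  refine Runs.seq (Runs.copy ?_ (by rw [hM1]; rfl))
  have hc : update (update s₁ (M + 1) (s₁ 0)) 0 (update s₁ (M + 1) (s₁ 0) M) (M + 1)
      = enc (b a) := by
    rw [update_of_ne (by omega), update_self, h1]
  have hfr : ∀ s₂ : Store, (∀ i, M ≤ i → s₂ i = update (update s₁ (M + 1) (s₁ 0)) 0
      (update s₁ (M + 1) (s₁ 0) M) i) → ∀ i, M + 2 ≤ i → s₂ i = s i := by
    intro s₂ h i hi
    rw [h i (by omega), update_of_ne (by omega), update_of_ne (by omega), h1' _ (by omega),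
      update_of_ne (by omega)]
  refine Runs.ite (fun h => ?_) (fun h => ?_)
  · refine (hp a _ (by rw [update_self, hM1])).mono (fun s₂ h2 => ⟨?_, hfr s₂ h2.2⟩) (by omega)
    rw [h2.1]
    rw [hc] at h
    cases hba : b a
    · simp [hba, enc, no] at h
    · simp
  · refine (hq a _ (by rw [update_self, hM1])).mono (fun s₂ h2 => ⟨?_, hfr s₂ h2.2⟩) (by omega)
    rw [h2.1]
    rw [hc] at h
    cases hba : b a
    · simp
    · simp [hba, enc, yes] at h

end PolyFun

theorem sz_nil : sz ([] : List α) = 0 := rfl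

theorem sz_cons (a : α) (l : List α) : sz (a :: l) = sz a + sz l + 1 := rfl

theorem sz_prod (a : α) (b : β) : sz (a, b) = sz a + sz b + 1 := rfl

theorem sz_append (l l' : List α) : sz (l ++ l') = sz l + sz l' := by
  induction l with
  | nil => simp [sz_nil]
  | cons a l ih => rw [List.cons_append, sz_cons, sz_cons, ih]; omega

theorem sz_le_of_mem {a : α} {l : List α} (h : a ∈ l) : sz a ≤ sz l := by
  induction l with
  | nil => simp at h
  | cons b l ih =>
    rw [sz_cons]
    rcases List.mem_cons.1 h with rfl | h
    · omega
    · have := ih h; omega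

theorem length_le_sz (l : List α) : l.length ≤ sz l := by
  induction l with
  | nil => simp
  | cons b l ih => rw [sz_cons, List.length_cons]; omega

/-- The loop that computes a fold: the parameter is in register `K`, the rest of the list in
register `K + 1` and the state in register `K + 2`. -/
theorem runs_foldl {p : Prog} {K : ℕ} {P : Polynomial ℕ} {step : γ → β → α → β} (hK : 0 < K)
    (hp : Computes p K P fun x : γ × β × α => step x.1 x.2.1 x.2.2) (c : γ) (S : ℕ)
    (hc : sz c ≤ S) (l : List α) (b : β) (hl : sz l ≤ S)
    (hb : ∀ l', l' <+: l → sz (l'.foldl (step c) b) ≤ S) (s : Store) (h0 : s K = enc c)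
    (h1 : s (K + 1) = enc l) (h2 : s (K + 2) = enc b) :
    Runs (.loop (K + 1) (.seq (.head (K + 3) (K + 1)) (.seq (.tail (K + 1) (K + 1))
      (.seq (.cons 0 (K + 2) (K + 3)) (.seq (.cons 0 K 0) (.seq p (.copy (K + 2) 0))))))) s
      (fun s' => s' (K + 2) = enc (l.foldl (step c) b) ∧ ∀ i, K + 4 ≤ i → s' i = s i)
      (1 + l.length * (9 + 8 * S + P.eval (3 * S + 2))) := by
  induction l generalizing b s with
  | nil => exact Runs.mono (Runs.loop_done h1 ⟨h2, fun _ _ => rfl⟩) (fun _ h => h) (by simp)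
  | cons a l ih =>
    rw [sz_cons] at hl
    have hb0 : sz b ≤ S := hb [] (by simp)
    have hb1 : sz (step c b a) ≤ S := hb [a] (by simp)
    refine Runs.mono (Q := _) (B := 1 + (1 + S + (1 + S + (2 + 2 * S + (2 + (3 * S + 1) +
      (P.eval (3 * S + 2) + (1 + S)))))) + (1 + l.length * (9 + 8 * S + P.eval (3 * S + 2))))
      (Runs.loop_step (by rw [h1]; simp [enc, encList]) ?_) (fun _ h => h)
      (by rw [List.length_cons, Nat.succ_mul l.length]; omega)
    have hleft : (s (K + 1)).left = enc a := by rw [h1]; rfl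
    refine Runs.seq (Runs.head ?_ (by rw [hleft]; show sz a ≤ S; omega))
    obtain ⟨s₁, hs₁⟩ : ∃ s₁, s₁ = update s (K + 3) (s (K + 1)).left := ⟨_, rfl⟩
    rw [← hs₁]
    have e1 : s₁ (K + 1) = enc (a :: l) := by rw [hs₁, update_of_ne (by omega), h1]
    have hright : (s₁ (K + 1)).right = enc l := by rw [e1]; rfl
    refine Runs.seq (Runs.tail ?_ (by rw [hright]; show sz l ≤ S; omega))
    obtain ⟨s₂, hs₂⟩ : ∃ s₂, s₂ = update s₁ (K + 1) (s₁ (K + 1)).right := ⟨_, rfl⟩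
    rw [← hs₂]
    have e2 : s₂ (K + 2) = enc b := by
      rw [hs₂, hs₁, update_of_ne (by omega), update_of_ne (by omega), h2]
    have e3 : s₂ (K + 3) = enc a := by
      rw [hs₂, hs₁, update_of_ne (by omega), update_self, hleft]
    refine Runs.seq (Runs.cons ?_ (by rw [e2, e3]; show sz b + sz a ≤ 2 * S; omega))
    obtain ⟨s₃, hs₃⟩ : ∃ s₃, s₃ = update s₂ 0 (node () (s₂ (K + 2)) (s₂ (K + 3))) := ⟨_, rfl⟩
    rw [← hs₃]
    have e4 : s₃ 0 = enc (b, a) := by rw [hs₃, update_self, e2, e3]; rfl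
    have e5 : s₃ K = enc c := by
      rw [hs₃, hs₂, hs₁, update_of_ne (by omega), update_of_ne (by omega),
        update_of_ne (by omega), h0]
    refine Runs.seq (Runs.cons ?_ (by
      rw [e4, e5]; show sz c + sz (b, a) ≤ 3 * S + 1; rw [sz_prod]; omega))
    refine Runs.seq ((hp (c, b, a) _ (by rw [update_self, e4, e5]; rfl)).mono ?_
      (polynomial_eval_mono _ (by rw [sz_prod, sz_prod]; omega)))
    rintro s₄ ⟨h4, h4'⟩
    refine Runs.copy ?_ (by rw [h4]; exact hb1)
    obtain ⟨s₅, hs₅⟩ : ∃ s₅, s₅ = update s₄ (K + 2) (s₄ 0) := ⟨_, rfl⟩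
    rw [← hs₅]
    have fr : ∀ i, K ≤ i → i ≠ K + 2 → s₅ i = s₂ i := by
      intro i hi hi'
      rw [hs₅, update_of_ne hi', h4' i hi, update_of_ne (by omega), hs₃,
        update_of_ne (by omega)]
    refine (ih (step c b a) (by omega) (fun l' hl' => ?_) s₅ ?_ ?_ ?_).mono ?_ le_rfl
    · exact hb (a :: l') (by simpa using hl')
    · rw [fr K le_rfl (by omega), ← e5, hs₃, update_of_ne (by omega)]
    · rw [fr (K + 1) (by omega) (by omega), hs₂, update_self, hright]
    · rw [hs₅, update_self, h4]
    · rintro s₆ ⟨h6, h6'⟩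
      refine ⟨h6, fun i hi => ?_⟩
      rw [h6' i hi, fr i (by omega) (by omega), hs₂, hs₁, update_of_ne (by omega),
        update_of_ne (by omega)]

namespace PolyFun

/-- Folds whose intermediate states stay polynomially bounded are computable in polynomial time. -/
theorem foldl_of_bound {l : γ → List α} {b : γ → β} {step : γ → β → α → β} (hl : PolyFun l)
    (hb : PolyFun b) (hs : PolyFun fun x : γ × β × α => step x.1 x.2.1 x.2.2)
    (hbd : ∃ Q : Polynomial ℕ, ∀ c l', l' <+: l c →
      sz (l'.foldl (step c) (b c)) ≤ Q.eval (sz c)) :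
    PolyFun fun c => (l c).foldl (step c) (b c) := by
  obtain ⟨r, N, R, hN, hr⟩ := hl
  obtain ⟨q, L, Q, hL, hq⟩ := hb
  obtain ⟨p, K, P, hK, hp⟩ := hs
  obtain ⟨W, hW⟩ := hbd
  obtain ⟨M, hM⟩ : ∃ M, M = max N (max K L) := ⟨_, rfl⟩
  replace hr := hr.mono (show N ≤ M by omega)
  replace hp := hp.mono (show K ≤ M by omega)
  replace hq := hq.mono (show L ≤ M by omega)
  -- a common bound for the parameter, the list and the states
  obtain ⟨S, hS⟩ : ∃ S : Polynomial ℕ, S = .X + R + W := ⟨_, rfl⟩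
  have hSe : ∀ n, S.eval n = n + R.eval n + W.eval n := by simp [hS]
  refine ⟨.seq (.copy M 0) (.seq r (.seq (.copy (M + 1) 0) (.seq (.copy 0 M) (.seq q
    (.seq (.copy (M + 2) 0) (.seq (.loop (M + 1) (.seq (.head (M + 3) (M + 1))
      (.seq (.tail (M + 1) (M + 1)) (.seq (.cons 0 (M + 2) (M + 3)) (.seq (.cons 0 M 0)
      (.seq p (.copy (M + 2) 0))))))) (.copy 0 (M + 2)))))))), M + 4,
    (1 + .X) + (R + ((1 + S) + ((1 + .X) + (Q + ((1 + (.X + Q)) +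
      ((1 + S * (9 + 8 * S + P.comp (3 * S + 2))) + (1 + S))))))), by omega, fun c s hs => ?_⟩
  simp only [Polynomial.eval_add, Polynomial.eval_one, Polynomial.eval_X, Polynomial.eval_ofNat,
    Polynomial.eval_mul, Polynomial.eval_comp]
  have hlS : sz (l c) ≤ S.eval (sz c) := by
    rw [hSe]; have := hr.sz_le c; omega
  refine Runs.seq (Runs.copy ?_ (by rw [hs]; rfl))
  refine Runs.seq ((hr c _ (by rw [update_of_ne (by omega), hs])).mono ?_ le_rfl)
  rintro s₁ ⟨h1, h1'⟩
  refine Runs.seq (Runs.copy ?_ (by rw [h1]; exact hlS))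
  have hM1 : update s₁ (M + 1) (s₁ 0) M = enc c := by
    rw [update_of_ne (by omega), h1' M le_rfl, update_self, hs]
  refine Runs.seq (Runs.copy ?_ (by rw [hM1]; rfl))
  refine Runs.seq ((hq c _ (by rw [update_self, hM1])).mono ?_ le_rfl)
  rintro s₂ ⟨h2, h2'⟩
  refine Runs.seq (Runs.copy ?_ (by rw [h2]; exact hq.sz_le c))
  have hpre : ∀ l', l' <+: l c → sz (l'.foldl (step c) (b c)) ≤ S.eval (sz c) := fun l' h => by
    rw [hSe]; have := hW c l' h; omega
  refine Runs.seq ((runs_foldl (by omega) hp c (S.eval (sz c)) (by rw [hSe]; omega) (l c) (b c)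
    hlS hpre _ ?_ ?_ ?_).mono ?_ ?_)
  · rw [update_of_ne (by omega), h2' _ (by omega), update_of_ne (by omega), hM1]
  · rw [update_of_ne (by omega), h2' _ (by omega), update_of_ne (by omega), update_self, h1]
  · rw [update_self, h2]
  · rintro s₃ ⟨h3, h3'⟩
    refine Runs.copy ⟨by rw [update_self, h3], fun i hi => ?_⟩
      (by rw [h3]; exact hpre _ (List.prefix_refl _))
    rw [update_of_ne (by omega), h3' i hi, update_of_ne (by omega), h2' _ (by omega),
      update_of_ne (by omega), update_of_ne (by omega), h1' _ (by omega),
      update_of_ne (by omega)]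
  · exact Nat.add_le_add_left (Nat.mul_le_mul_right _ ((length_le_sz _).trans hlS)) _

/-- Folds whose states grow by a polynomially bounded amount in each step. -/
theorem foldl_of_growth {l : γ → List α} {b : γ → β} {step : γ → β → α → β} (hl : PolyFun l)
    (hb : PolyFun b) (hs : PolyFun fun x : γ × β × α => step x.1 x.2.1 x.2.2)
    (hbd : ∃ Q : Polynomial ℕ, ∀ c, ∀ a ∈ l c, ∀ y, sz (step c y a) ≤ sz y + Q.eval (sz c)) :
    PolyFun fun c => (l c).foldl (step c) (b c) := by
  obtain ⟨Q, hQ⟩ := hbd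
  obtain ⟨R, hR⟩ := hl.sz_le
  obtain ⟨T, hT⟩ := hb.sz_le
  refine foldl_of_bound hl hb hs ⟨T + R * Q, fun c l' hl' => ?_⟩
  have key : ∀ (l' : List α) (y : β), (∀ a ∈ l', a ∈ l c) →
      sz (l'.foldl (step c) y) ≤ sz y + l'.length * Q.eval (sz c) := by
    intro l'
    induction l' with
    | nil => simp
    | cons a l' ih =>
      intro y h
      have h1 := ih (step c y a) fun a' h' => h a' (List.mem_cons_of_mem _ h')
      have h2 := hQ c a (h a (by simp)) y
      rw [List.foldl_cons, List.length_cons, Nat.succ_mul]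
      omega
  rw [Polynomial.eval_add, Polynomial.eval_mul]
  refine (key l' (b c) fun a h => hl'.subset h).trans (Nat.add_le_add (hT c) ?_)
  exact Nat.mul_le_mul_right _ (hl'.length_le.trans ((length_le_sz _).trans (hR c)))

end PolyFun

/-! ### Polynomial-time operations on lists, numbers and truth values -/

theorem sz_bool_le (b : Bool) : sz b ≤ 1 := by cases b <;> simp [sz, enc, yes, no]

theorem enc_replicate (n : ℕ) : enc (List.replicate n ()) = enc n := by
  simp [enc, encNat]

/-- A tree, read as the list that it encodes. -/
def treeToList : BinaryTree Unit → List (BinaryTree Unit)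
  | .nil => []
  | .node _ a b => a :: treeToList b

theorem enc_treeToList (t : BinaryTree Unit) : enc (treeToList t) = t := by
  induction t with
  | nil => rfl
  | node u a b _ ih =>
    change BinaryTree.node () a (enc (treeToList b)) = _
    rw [ih]

theorem treeToList_encList (l : List (BinaryTree Unit)) : treeToList (encList l) = l := by
  induction l with
  | nil => rfl
  | cons a l ih => simp [encList, treeToList, ih]

namespace PolyFun

@[fun_prop]
theorem enc {f : α → β} (hf : PolyFun f) : PolyFun fun a => enc (f a) :=
  hf.of_enc_eq fun _ => rfl

@[fun_prop]
theorem treeToList {f : α → BinaryTree Unit} (hf : PolyFun f) :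
    PolyFun fun a => treeToList (f a) :=
  hf.of_enc_eq fun a => (enc_treeToList (f a)).symm

@[fun_prop]
theorem treeLeft {f : α → BinaryTree Unit} (hf : PolyFun f) : PolyFun fun a => (f a).left :=
  hf.left fun _ => rfl

@[fun_prop]
theorem treeRight {f : α → BinaryTree Unit} (hf : PolyFun f) : PolyFun fun a => (f a).right :=
  hf.right fun _ => rfl

@[fun_prop]
theorem treeNode {f g : α → BinaryTree Unit} (hf : PolyFun f) (hg : PolyFun g) :
    PolyFun fun a => BinaryTree.node () (f a) (g a) :=
  hf.node hg fun _ => rfl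

@[fun_prop]
theorem cons {f : γ → α} {l : γ → List α} (hf : PolyFun f) (hl : PolyFun l) :
    PolyFun fun c => f c :: l c :=
  hf.node hl fun _ => rfl

@[fun_prop]
theorem tail {l : γ → List α} (hl : PolyFun l) : PolyFun fun c => (l c).tail :=
  hl.right fun c => by cases l c <;> rfl

@[fun_prop]
theorem reverse {l : γ → List α} (hl : PolyFun l) : PolyFun fun c => (l c).reverse := by
  obtain ⟨L, hL⟩ := hl.sz_le
  have : PolyFun fun c => (l c).foldl (fun acc a => a :: acc) [] :=
    hl.foldl_of_growth (const []) (by fun_prop) ⟨L + 1, fun c a ha y => by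
      have := sz_le_of_mem ha
      have := hL c
      simp only [sz_cons, Polynomial.eval_add, Polynomial.eval_one]
      omega⟩
  simpa using this

@[fun_prop]
theorem append {l l' : γ → List α} (hl : PolyFun l) (hl' : PolyFun l') :
    PolyFun fun c => l c ++ l' c := by
  obtain ⟨L, hL⟩ := hl.sz_le
  have : PolyFun fun c => (l c).reverse.foldl (fun acc a => a :: acc) (l' c) :=
    hl.reverse.foldl_of_growth hl' (by fun_prop) ⟨L + 1, fun c a ha y => by
      have := sz_le_of_mem (List.mem_reverse.1 ha)
      have := hL c
      simp only [sz_cons, Polynomial.eval_add, Polynomial.eval_one]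
      omega⟩
  simpa using this

@[fun_prop]
theorem flatMap {l : γ → List α} {g : γ → α → List β} (hl : PolyFun l)
    (hg : PolyFun fun p : γ × α => g p.1 p.2) : PolyFun fun c => (l c).flatMap (g c) := by
  obtain ⟨L, hL⟩ := hl.sz_le
  obtain ⟨G, hG⟩ := hg.sz_le
  have : PolyFun fun c => (l c).foldl (fun acc a => acc ++ g c a) [] := by
    refine hl.foldl_of_growth (step := fun c acc a => acc ++ g c a) (const [])
      (append (by fun_prop) (hg.comp (f := fun x : γ × List β × α => (x.1, x.2.2))
      (by fun_prop))) ⟨G.comp (.X + L + 1), fun c a ha y => ?_⟩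
    have h1 := sz_le_of_mem ha
    have h2 := hL c
    rw [sz_append, Polynomial.eval_comp]
    refine Nat.add_le_add_left ((hG (c, a)).trans (polynomial_eval_mono _ ?_)) _
    simp only [sz_prod, Polynomial.eval_add, Polynomial.eval_one, Polynomial.eval_X]
    omega
  refine (this.of_enc_eq fun c => ?_)
  have key : ∀ (l : List α) (acc : List β),
      l.foldl (fun acc a => acc ++ g c a) acc = acc ++ l.flatMap (g c) := by
    intro l
    induction l with
    | nil => simp
    | cons a l ih => intro acc; simp [ih]
  rw [key, List.nil_append]

@[fun_prop]
theorem map {l : γ → List α} {g : γ → α → β} (hl : PolyFun l)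
    (hg : PolyFun fun p : γ × α => g p.1 p.2) : PolyFun fun c => (l c).map (g c) := by
  have : PolyFun fun c => (l c).flatMap fun a => [g c a] := hl.flatMap (hg.cons (const []))
  simpa [List.map_eq_flatMap] using this

@[fun_prop]
theorem filter {l : γ → List α} {g : γ → α → Bool} (hl : PolyFun l)
    (hg : PolyFun fun p : γ × α => g p.1 p.2) : PolyFun fun c => (l c).filter (g c) := by
  have : PolyFun fun c => (l c).flatMap fun a => if g c a then [a] else [] :=
    hl.flatMap (hg.ite (by fun_prop) (const []))
  refine (this.of_enc_eq fun c => ?_)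
  congr 1
  induction l c with
  | nil => rfl
  | cons a l ih => rw [List.flatMap_cons, ih, List.filter_cons]; split_ifs <;> rfl

@[fun_prop]
theorem and {b b' : γ → Bool} (h : PolyFun b) (h' : PolyFun b') : PolyFun fun c => b c && b' c := by
  have : PolyFun fun c => if b c then b' c else false := by fun_prop
  refine (this.of_enc_eq fun c => ?_)
  cases b c <;> rfl

@[fun_prop]
theorem not {b : γ → Bool} (h : PolyFun b) : PolyFun fun c => !b c := by
  have : PolyFun fun c => if b c then false else true := by fun_prop
  refine (this.of_enc_eq fun c => ?_)
  cases b c <;> rfl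

@[fun_prop]
theorem all {l : γ → List α} {g : γ → α → Bool} (hl : PolyFun l)
    (hg : PolyFun fun p : γ × α => g p.1 p.2) : PolyFun fun c => (l c).all (g c) := by
  have : PolyFun fun c => (l c).foldl (fun acc a => acc && g c a) true := by
    refine hl.foldl_of_growth (step := fun c acc a => acc && g c a) (const true)
      (and (by fun_prop) (hg.comp (f := fun x : γ × Bool × α => (x.1, x.2.2)) (by fun_prop)))
      ⟨1, fun c a _ y => ?_⟩
    rw [Polynomial.eval_one]
    exact (sz_bool_le _).trans (by omega)
  refine (this.of_enc_eq fun c => ?_)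
  have key : ∀ (l : List α) (acc : Bool),
      l.foldl (fun acc a => acc && g c a) acc = (acc && l.all (g c)) := by
    intro l
    induction l with
    | nil => simp
    | cons a l ih => intro acc; simp [ih, Bool.and_assoc]
  rw [key, Bool.true_and]

@[fun_prop]
theorem any {l : γ → List α} {g : γ → α → Bool} (hl : PolyFun l)
    (hg : PolyFun fun p : γ × α => g p.1 p.2) : PolyFun fun c => (l c).any (g c) := by
  have : PolyFun fun c => !(l c).all fun a => !g c a := (hl.all hg.not).not
  simpa [List.not_all_eq_any_not] using this

@[fun_prop]
theorem isEmpty {l : γ → List α} (hl : PolyFun l) : PolyFun fun c => (l c).isEmpty := by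
  have : PolyFun fun c => (l c).all fun _ => false := hl.all (const false)
  refine (this.of_enc_eq fun c => ?_)
  cases l c <;> rfl

@[fun_prop]
theorem headD {l : γ → List α} {d : γ → α} (hl : PolyFun l) (hd : PolyFun d) :
    PolyFun fun c => (l c).headD (d c) := by
  obtain ⟨L, hL⟩ := hl.sz_le
  have : PolyFun fun c => (l c).reverse.foldl (fun _ a => a) (d c) :=
    hl.reverse.foldl_of_growth hd (by fun_prop) ⟨L, fun c a ha y =>
      (sz_le_of_mem (List.mem_reverse.1 ha)).trans ((hL c).trans (by omega))⟩
  refine (this.of_enc_eq fun c => ?_)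
  cases l c <;> simp

@[fun_prop]
theorem replicate_unit {f : γ → ℕ} (hf : PolyFun f) :
    PolyFun fun c => List.replicate (f c) () :=
  hf.of_enc_eq fun _ => (enc_replicate _).symm

@[fun_prop]
theorem length {l : γ → List α} (hl : PolyFun l) : PolyFun fun c => (l c).length := by
  have : PolyFun fun c => (l c).map fun _ => () := hl.map (const ())
  refine (this.of_enc_eq fun c => ?_)
  rw [List.map_const', enc_replicate]

@[fun_prop]
theorem drop {n : γ → ℕ} {l : γ → List α} (hn : PolyFun n) (hl : PolyFun l) :
    PolyFun fun c => (l c).drop (n c) := by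
  have : PolyFun fun c => (List.replicate (n c) ()).foldl (fun acc _ => acc.tail) (l c) :=
    hn.replicate_unit.foldl_of_growth hl (by fun_prop) ⟨0, fun c _ _ y => by
      cases y with
      | nil => simp
      | cons a y => rw [List.tail_cons, sz_cons]; omega⟩
  refine (this.of_enc_eq fun c => ?_)
  congr 1
  generalize l c = l
  induction n c generalizing l with
  | zero => rfl
  | succ n ih => rw [List.replicate_succ, List.foldl_cons, ih, List.drop_tail]

@[fun_prop]
theorem getD {l : γ → List α} {n : γ → ℕ} {d : γ → α} (hl : PolyFun l) (hn : PolyFun n)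
    (hd : PolyFun d) : PolyFun fun c => (l c).getD (n c) (d c) := by
  have : PolyFun fun c => ((l c).drop (n c)).headD (d c) := by fun_prop
  refine (this.of_enc_eq fun c => ?_)
  rw [List.headD_eq_head?_getD, List.head?_drop, List.getD_eq_getElem?_getD]

@[fun_prop]
theorem natSub {m n : γ → ℕ} (hm : PolyFun m) (hn : PolyFun n) :
    PolyFun fun c => m c - n c := by
  have : PolyFun fun c => ((List.replicate (m c) ()).drop (n c)).length := by fun_prop
  simpa using this

@[fun_prop]
theorem natEq {m n : γ → ℕ} (hm : PolyFun m) (hn : PolyFun n) :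
    PolyFun fun c => decide (m c = n c) := by
  have : PolyFun fun c => (List.replicate (m c - n c) ()).isEmpty &&
    (List.replicate (n c - m c) ()).isEmpty := by fun_prop
  refine (this.of_enc_eq fun c => ?_)
  congr 1
  rw [Bool.eq_iff_iff]
  simp only [Bool.and_eq_true, List.isEmpty_iff, List.replicate_eq_nil_iff, decide_eq_true_eq]
  omega

theorem sz_range_le (n : ℕ) : sz (List.range n) ≤ n * (n + 1) := by
  induction n with
  | zero => simp [sz_nil]
  | succ n ih =>
    have : sz n = n := by
      have : ∀ l : List Unit, sz l = l.length := fun l => by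
        induction l with
        | nil => rfl
        | cons a l ih => rw [sz_cons, ih, List.length_cons]; simp [sz, TreeEnc.enc]
      simpa [sz, enc_replicate] using this (List.replicate n ())
    rw [List.range_succ, sz_append, sz_cons, sz_nil, this]
    nlinarith

@[fun_prop]
theorem range {n : γ → ℕ} (hn : PolyFun n) : PolyFun fun c => List.range (n c) := by
  obtain ⟨N, hN⟩ := hn.replicate_unit.sz_le
  have key : ∀ l : List Unit,
      l.foldl (fun acc _ => acc ++ [acc.length]) [] = List.range l.length := by
    intro l
    induction l using List.reverseRecOn with
    | nil => rfl
    | append_singleton l a ih => simp [ih, List.range_succ]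
  have : PolyFun fun c => (List.replicate (n c) ()).foldl
      (fun (acc : List ℕ) _ => acc ++ [acc.length]) [] := by
    refine hn.replicate_unit.foldl_of_bound (const []) (by fun_prop)
      ⟨N * (N + 1), fun c l' hl' => ?_⟩
    rw [key]
    refine (sz_range_le _).trans ?_
    have h : l'.length ≤ N.eval (sz c) :=
      hl'.length_le.trans ((length_le_sz _).trans (hN c))
    simp only [Polynomial.eval_mul, Polynomial.eval_add, Polynomial.eval_one]
    exact Nat.mul_le_mul h (by omega)
  simpa [key] using this

@[fun_prop]
theorem listNatEq {l l' : γ → List ℕ} (hl : PolyFun l) (hl' : PolyFun l') :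
    PolyFun fun c => decide (l c = l' c) := by
  have : PolyFun fun c => decide ((l c).length = (l' c).length) &&
      (List.range (l c).length).all fun i => decide ((l c).getD i 0 = (l' c).getD i 0) := by
    fun_prop
  refine (this.of_enc_eq fun c => ?_)
  congr 1
  rw [Bool.eq_iff_iff]
  simp only [Bool.and_eq_true, List.all_eq_true, decide_eq_true_eq, List.mem_range]
  constructor
  · rintro ⟨h, h'⟩
    refine List.ext_getElem h fun i hi hi' => ?_
    have := h' i hi
    rwa [List.getD_eq_getElem _ _ hi, List.getD_eq_getElem _ _ hi'] at this
  · rintro h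
    simp [h]

@[fun_prop]
theorem listNatMem {l : γ → List ℕ} {L : γ → List (List ℕ)} (hl : PolyFun l) (hL : PolyFun L) :
    PolyFun fun c => decide (l c ∈ L c) := by
  have : PolyFun fun c => (L c).any fun u => decide (l c = u) := by fun_prop
  refine (this.of_enc_eq fun c => ?_)
  congr 1
  rw [Bool.eq_iff_iff]
  simp

/-- A finite family of polynomial-time functions, indexed by a list that does not depend on the
input. -/
theorem map_const_list {ι : Type} (is : List ι) {g : ι → γ → β} (hg : ∀ i, PolyFun (g i)) :
    PolyFun fun c => is.map fun i => g i c := by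
  induction is with
  | nil => exact const []
  | cons i is ih => exact (hg i).cons ih

theorem flatMap_const_list {ι : Type} (is : List ι) {g : ι → γ → List β}
    (hg : ∀ i, PolyFun (g i)) : PolyFun fun c => is.flatMap fun i => g i c := by
  induction is with
  | nil => exact const []
  | cons i is ih => exact (hg i).append ih

end PolyFun

/-! ### Structures as raw data -/

/-- All lists of length `k` with entries from `l`, in lexicographic order. -/
def tuplesOf {α : Type} (l : List α) : ℕ → List (List α)
  | 0 => [[]]
  | k + 1 => l.flatMap fun a => (tuplesOf l k).map (a :: ·)

theorem mem_tuplesOf {α : Type} {l : List α} {k : ℕ} {u : List α} :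
    u ∈ tuplesOf l k ↔ u.length = k ∧ ∀ a ∈ u, a ∈ l := by
  induction k generalizing u with
  | zero => simp +contextual [tuplesOf, List.length_eq_zero_iff]
  | succ k ih =>
    simp only [tuplesOf, List.mem_flatMap, List.mem_map, ih]
    constructor
    · rintro ⟨a, ha, u, ⟨h1, h2⟩, rfl⟩
      simp only [List.length_cons, h1, List.mem_cons, true_and]
      rintro b (rfl | hb)
      · exact ha
      · exact h2 b hb
    · rintro ⟨h1, h2⟩
      match u, h1, h2 with
      | a :: u, h1, h2 =>
        exact ⟨a, h2 a (by simp), u,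
          ⟨by simpa using h1, fun b hb => h2 b (List.mem_cons_of_mem _ hb)⟩, rfl⟩

@[fun_prop]
theorem PolyFun.tuplesOf {l : γ → List α} (hl : PolyFun l) (k : ℕ) :
    PolyFun fun c => tuplesOf (l c) k := by
  induction k with
  | zero => exact PolyFun.const [[]]
  | succ k ih => exact hl.flatMap ((ih.comp PolyFun.fst).map (by fun_prop))

/-- The data of a structure: the size of its universe, and the arities and tuples of its
relations. -/
abbrev RawStr : Type := ℕ × List (ℕ × List (List ℕ))

/-- The data of an explicitly given structure. -/
def rawOf {τ : List ℕ} (H : FinStr τ) : RawStr :=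
  (H.size, List.ofFn fun i => (τ.get i, (H.tuples i).map fun u => u.map Fin.val))

theorem encTuple_eq {n : ℕ} :
    encTuple (n := n) = fun u => encList (u.map fun a => encNat a.val) := by
  funext u
  unfold encTuple
  induction u with
  | nil => rfl
  | cons a u ih => simp_all [encList]

theorem enc_rawOf {τ : List ℕ} (H : FinStr τ) : enc (rawOf H) = encStr H := by
  simp only [enc, rawOf, encStr, List.map_ofFn]
  congr 3
  funext i
  simp [Function.comp_def, encTuple_eq]

/-- The length of the list that a tree encodes. -/
def treeToNat (t : BinaryTree Unit) : ℕ := (treeToList t).length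

theorem treeToNat_encNat (n : ℕ) : treeToNat (encNat n) = n := by
  rw [treeToNat, encNat, treeToList_encList, List.length_replicate]

/-- The data of a structure that a tree encodes; every tree is read as such data. -/
def treeToRaw (t : BinaryTree Unit) : RawStr :=
  (treeToNat t.left, (treeToList t.right).map fun r =>
    (treeToNat r.left, (treeToList r.right).map fun u => (treeToList u).map treeToNat))

theorem treeToRaw_encStr {τ : List ℕ} (H : FinStr τ) : treeToRaw (encStr H) = rawOf H := by
  simp only [treeToRaw, encStr, encPair, BinaryTree.left, BinaryTree.right, treeToNat_encNat,
    treeToList_encList, rawOf, List.map_ofFn]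
  congr 2
  funext i
  simp [encTuple_eq, Function.comp_def, treeToList_encList, treeToNat_encNat]

@[fun_prop]
theorem PolyFun.treeToNat {f : α → BinaryTree Unit} (hf : PolyFun f) :
    PolyFun fun a => treeToNat (f a) := by
  unfold CSPMeta.treeToNat; fun_prop

theorem PolyFun.treeToRaw : PolyFun treeToRaw := by
  unfold CSPMeta.treeToRaw; fun_prop

/-! ### The indicator instance -/

/-- The element of the indicator instance that stands for the value of the operation symbol `i` at
the argument `x`. -/
def point (M : MaltsevCondition) (i : Fin M.m) (x : Fin (M.ar i) → ℕ) : List ℕ :=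
  i.val :: (List.finRange (M.ar i)).map x

@[fun_prop]
theorem PolyFun.point (M : MaltsevCondition) (i : Fin M.m) {x : γ → Fin (M.ar i) → ℕ}
    (hx : ∀ j, PolyFun fun c => x c j) : PolyFun fun c => point M i (x c) :=
  (PolyFun.const i.val).cons (PolyFun.map_const_list _ hx)

/-- The universe of the indicator instance over `{0, …, n - 1}`.  Elements are numbered by their
place in this list. -/
def points (M : MaltsevCondition) (n : ℕ) : List (List ℕ) :=
  (List.finRange M.m).flatMap fun i =>
    (tuplesOf (List.range n) (M.ar i)).map fun x => point M i fun j => x.getD j 0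

/-- The first place at which `e` occurs in `E`. -/
def position (E : List (List ℕ)) (e : List ℕ) : ℕ :=
  ((List.range E.length).filter fun j => decide (E.getD j [] = e)).headD 0

/-- A relation of a CSP instance: its arity, its tuples in the left-hand structure and its tuples
in the right-hand structure. -/
abbrev Constraint : Type := ℕ × List (List ℕ) × List (List ℕ)

/-- The tuples which say that the operations preserve the `r`-ary relation `B`: for each symbol
of arity `k` and all `k` tuples of `B`, the list of the points given by the rows. -/
def liftTuples (M : MaltsevCondition) (E : List (List ℕ)) (r : ℕ) (B : List (List ℕ)) :
    List (List ℕ) :=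
  (List.finRange M.m).flatMap fun i => (tuplesOf B (M.ar i)).map fun us =>
    (List.range r).map fun p => position E (point M i fun j => (us.getD j []).getD p 0)

/-- The pairs of points that an identity between two operation terms makes equal.  The list `v`
holds the values of the variables, all of which are less than `V`. -/
def equalPairs (M : MaltsevCondition) (V n : ℕ) (E : List (List ℕ)) : List (List ℕ) :=
  M.ids.flatMap fun e => match e.rhs with
    | .var _ => []
    | .app f xs => (tuplesOf (List.range n) V).map fun v =>
        [position E (point M e.sym fun j => v.getD (e.args j) 0),
          position E (point M f fun j => v.getD (xs j) 0)]

/-- The values that the identities whose right-hand side is a variable prescribe: pairs of a point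
and its value. -/
def identityPins (M : MaltsevCondition) (V n : ℕ) (E : List (List ℕ)) : List (ℕ × ℕ) :=
  M.ids.flatMap fun e => match e.rhs with
    | .var y => (tuplesOf (List.range n) V).map fun v =>
        (position E (point M e.sym fun j => v.getD (e.args j) 0), v.getD y 0)
    | .app _ _ => []

/-- The relations of the indicator instance, without the constants. -/
def indicator (M : MaltsevCondition) (V : ℕ) (R : RawStr) : List Constraint :=
  (2, equalPairs M V R.1 (points M R.1), (List.range R.1).map fun a => [a, a]) ::
    R.2.map fun ρ => (ρ.1, liftTuples M (points M R.1) ρ.1 ρ.2, ρ.2)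

/-- For each `a < n` the singleton relation of `a`, imposed on the points that are pinned to `a`. -/
def pinConstraints (n : ℕ) (pins : List (ℕ × ℕ)) : List Constraint :=
  (List.range n).map fun a =>
    (1, (pins.filter fun q => decide (q.2 = a)).map fun q => [q.1], [[a]])

/-- The indicator instance with pins. -/
def pinned (M : MaltsevCondition) (V : ℕ) (R : RawStr) (pins : List (ℕ × ℕ)) :
    List Constraint :=
  indicator M V R ++ pinConstraints R.1 pins

/-- The encoding of the CSP instance with the relations `C`. -/
def encInstance (N n : ℕ) (C : List Constraint) : BinaryTree Unit :=
  encPair (enc ((N, C.map fun c => (c.1, c.2.1)) : RawStr))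
    (enc ((n, C.map fun c => (c.1, c.2.2)) : RawStr))

/-- The answer of the decision algorithm `f` to the pinned indicator instance. -/
def extendable (f : BinaryTree Unit → BinaryTree Unit) (M : MaltsevCondition) (V : ℕ) (R : RawStr)
    (pins : List (ℕ × ℕ)) : Bool :=
  !(treeToList (f (encInstance (points M R.1).length R.1 (pinned M V R pins)))).isEmpty

/-- One step of the search: the point `j` is pinned to the first value for which the decision
algorithm reports that the pins can still be extended. -/
def pinStep (f : BinaryTree Unit → BinaryTree Unit) (M : MaltsevCondition) (V : ℕ) (R : RawStr)
    (pins : List (ℕ × ℕ)) (j : ℕ) : List (ℕ × ℕ) :=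
  (j, ((List.range R.1).filter fun a => extendable f M V R ((j, a) :: pins)).headD 0) :: pins

/-- The search pins all points, one after the other. -/
def searchPins (f : BinaryTree Unit → BinaryTree Unit) (M : MaltsevCondition) (V : ℕ)
    (R : RawStr) : List (ℕ × ℕ) :=
  (List.range (points M R.1).length).foldl (pinStep f M V R) (identityPins M V R.1 (points M R.1))

/-- The value to which the point `j` is pinned. -/
def pinValue (pins : List (ℕ × ℕ)) (j : ℕ) : ℕ :=
  ((pins.filter fun q => decide (q.1 = j)).map fun q => q.2).headD 0

/-- The test whether `pinValue pins` satisfies all constraints. -/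
def solves (C : List Constraint) (pins : List (ℕ × ℕ)) : Bool :=
  C.all fun c => c.2.1.all fun u => decide (u.map (pinValue pins) ∈ c.2.2)

/-- The tables of the operations that `pinValue pins` describes. -/
def opTables (M : MaltsevCondition) (n : ℕ) (pins : List (ℕ × ℕ)) : List (List ℕ) :=
  (List.finRange M.m).map fun i => (tuplesOf (List.range n) (M.ar i)).map fun x =>
    pinValue pins (position (points M n) (point M i fun j => x.getD j 0))

/-- The algorithm for the creation-metaquestion that uses the decision algorithm `f`. -/
def createOps (f : BinaryTree Unit → BinaryTree Unit) (M : MaltsevCondition) (V : ℕ)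
    (R : RawStr) : BinaryTree Unit :=
  if solves (pinned M V R (searchPins f M V R)) (searchPins f M V R) then
    found (enc (opTables M R.1 (searchPins f M V R))) else no

namespace PolyFun

@[fun_prop]
theorem points (M : MaltsevCondition) {n : γ → ℕ} (hn : PolyFun n) :
    PolyFun fun c => points M (n c) := by
  refine flatMap_const_list _ fun i => ?_
  fun_prop

@[fun_prop]
theorem position {E : γ → List (List ℕ)} {e : γ → List ℕ} (hE : PolyFun E) (he : PolyFun e) :
    PolyFun fun c => position (E c) (e c) := by
  unfold CSPMeta.position; fun_prop

@[fun_prop]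
theorem liftTuples (M : MaltsevCondition) {E : γ → List (List ℕ)} {r : γ → ℕ}
    {B : γ → List (List ℕ)} (hE : PolyFun E) (hr : PolyFun r) (hB : PolyFun B) :
    PolyFun fun c => liftTuples M (E c) (r c) (B c) := by
  refine flatMap_const_list _ fun i => ?_
  fun_prop

@[fun_prop]
theorem equalPairs (M : MaltsevCondition) (V : ℕ) {n : γ → ℕ} {E : γ → List (List ℕ)}
    (hn : PolyFun n) (hE : PolyFun E) : PolyFun fun c => equalPairs M V (n c) (E c) := by
  refine flatMap_const_list _ fun e => ?_
  obtain ⟨i, xs, y | ⟨i', ys⟩⟩ := e <;> dsimp only <;> fun_prop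

@[fun_prop]
theorem identityPins (M : MaltsevCondition) (V : ℕ) {n : γ → ℕ} {E : γ → List (List ℕ)}
    (hn : PolyFun n) (hE : PolyFun E) : PolyFun fun c => identityPins M V (n c) (E c) := by
  refine flatMap_const_list _ fun e => ?_
  obtain ⟨i, xs, y | ⟨i', ys⟩⟩ := e <;> dsimp only <;> fun_prop

@[fun_prop]
theorem pinned (M : MaltsevCondition) (V : ℕ) {R : γ → RawStr} {pins : γ → List (ℕ × ℕ)}
    (hR : PolyFun R) (hp : PolyFun pins) : PolyFun fun c => pinned M V (R c) (pins c) := by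
  unfold CSPMeta.pinned CSPMeta.indicator CSPMeta.pinConstraints; fun_prop

@[fun_prop]
theorem extendable {f : BinaryTree Unit → BinaryTree Unit} (hf : PolyFun f) (M : MaltsevCondition)
    (V : ℕ) {R : γ → RawStr} {pins : γ → List (ℕ × ℕ)} (hR : PolyFun R) (hp : PolyFun pins) :
    PolyFun fun c => extendable f M V (R c) (pins c) := by
  unfold CSPMeta.extendable CSPMeta.encInstance encPair; fun_prop

@[fun_prop]
theorem searchPins {f : BinaryTree Unit → BinaryTree Unit} (hf : PolyFun f) (M : MaltsevCondition)
    (V : ℕ) {R : γ → RawStr} (hR : PolyFun R) : PolyFun fun c => searchPins f M V (R c) := by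
  obtain ⟨S, hS⟩ := (show PolyFun fun c => List.range (CSPMeta.points M (R c).1).length by
    fun_prop).sz_le
  obtain ⟨T, hT⟩ := (show PolyFun fun c => List.range (R c).1 by fun_prop).sz_le
  refine foldl_of_growth (step := fun c => pinStep f M V (R c)) (by fun_prop) (by fun_prop)
    (by unfold pinStep; fun_prop) ⟨S + T + 2, fun c j hj y => ?_⟩
  have h1 := (sz_le_of_mem hj).trans (hS c)
  have h2 : sz (((List.range (R c).1).filter fun a =>
      CSPMeta.extendable f M V (R c) ((j, a) :: y)).headD 0) ≤ T.eval (sz c) := by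
    cases h : (List.range (R c).1).filter fun a =>
        CSPMeta.extendable f M V (R c) ((j, a) :: y) with
    | nil => exact Nat.zero_le _
    | cons a l =>
      have : a ∈ (List.range (R c).1).filter fun a =>
        CSPMeta.extendable f M V (R c) ((j, a) :: y) := by rw [h]; simp
      exact (sz_le_of_mem (List.mem_of_mem_filter this)).trans (hT c)
  simp only [pinStep, sz_cons, sz_prod, Polynomial.eval_add, Polynomial.eval_ofNat]
  omega

@[fun_prop]
theorem pinValue {pins : γ → List (ℕ × ℕ)} {j : γ → ℕ} (hp : PolyFun pins) (hj : PolyFun j) :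
    PolyFun fun c => pinValue (pins c) (j c) := by
  unfold CSPMeta.pinValue; fun_prop

@[fun_prop]
theorem opTables (M : MaltsevCondition) {n : γ → ℕ} {pins : γ → List (ℕ × ℕ)} (hn : PolyFun n)
    (hp : PolyFun pins) : PolyFun fun c => opTables M (n c) (pins c) := by
  refine map_const_list _ fun i => ?_
  fun_prop

theorem createOps {f : BinaryTree Unit → BinaryTree Unit} (hf : PolyFun f)
    (M : MaltsevCondition) (V : ℕ) : PolyFun (createOps f M V) := by
  unfold CSPMeta.createOps solves found; fun_prop

end PolyFun

/-! ### Structures built from lists of relations -/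

/-- The residue of `x`, as an element of a universe of size `n`. -/
def toFin {n : ℕ} (hn : 0 < n) (x : ℕ) : Fin n := ⟨x % n, Nat.mod_lt _ hn⟩

theorem val_toFin {n : ℕ} (hn : 0 < n) {x : ℕ} (hx : x < n) : (toFin hn x).val = x :=
  Nat.mod_eq_of_lt hx

theorem toFin_val {n : ℕ} (hn : 0 < n) (x : Fin n) : toFin hn x.val = x :=
  Fin.ext (val_toFin hn x.isLt)

theorem map_val_map_toFin {n : ℕ} (hn : 0 < n) {u : List ℕ} (hu : ∀ x ∈ u, x < n) :
    (u.map (toFin hn)).map Fin.val = u := by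
  rw [List.map_map]
  conv_rhs => rw [← List.map_id u]
  exact List.map_congr_left fun x hx => val_toFin hn (hu x hx)

theorem mem_map_toFin {n : ℕ} (hn : 0 < n) {B : List (List ℕ)} (hB : ∀ u ∈ B, ∀ x ∈ u, x < n)
    (u : List (Fin n)) : u ∈ B.map (List.map (toFin hn)) ↔ u.map Fin.val ∈ B := by
  rw [List.mem_map]
  constructor
  · rintro ⟨w, hw, rfl⟩
    rwa [map_val_map_toFin hn (hB w hw)]
  · intro h
    refine ⟨_, h, ?_⟩
    rw [List.map_map]
    conv_rhs => rw [← List.map_id u]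
    exact List.map_congr_left fun x _ => toFin_val hn x

theorem map_mem_map_toFin {ι : Type} {n : ℕ} (hn : 0 < n) {B : List (List ℕ)}
    (hB : ∀ u ∈ B, ∀ x ∈ u, x < n) (f : ι → Fin n) (u : List ι) :
    u.map f ∈ B.map (List.map (toFin hn)) ↔ u.map (fun a => (f a).val) ∈ B := by
  rw [mem_map_toFin hn hB, List.map_map]
  rfl

/-- The structure of size `n` that has for each `c` in the list `C` a relation of arity `r c` with
the tuples `B c`, read modulo `n`. -/
def mkStr {κ : Type} (C : List κ) (r : κ → ℕ) (B : κ → List (List ℕ)) {n : ℕ} (hn : 0 < n)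
    (h : ∀ c ∈ C, ∀ u ∈ B c, u.length = r c) : FinStr (C.map r) where
  size := n
  size_pos := hn
  tuples i := (B (C.get (i.cast (by simp)))).map (List.map (toFin hn))
  length_eq i u hu := by
    obtain ⟨w, hw, rfl⟩ := List.mem_map.1 hu
    rw [List.length_map, h _ (List.get_mem _ _) w hw]
    simp

section mkStr

variable {κ : Type} {C : List κ} {r : κ → ℕ} {A B : κ → List (List ℕ)} {N n : ℕ} {hN : 0 < N}
  {hn : 0 < n} {hA : ∀ c ∈ C, ∀ u ∈ A c, u.length = r c} {h : ∀ c ∈ C, ∀ u ∈ B c, u.length = r c}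

theorem forall_fin_map_iff (p : κ → Prop) :
    (∀ i : Fin (C.map r).length, p (C.get (i.cast (by simp)))) ↔ ∀ c ∈ C, p c := by
  constructor
  · intro hp c hc
    obtain ⟨i, rfl⟩ := List.get_of_mem hc
    exact hp (i.cast (by simp))
  · exact fun hp i => hp _ (List.get_mem _ _)

theorem rawOf_mkStr (hlt : ∀ c ∈ C, ∀ u ∈ B c, ∀ x ∈ u, x < n) :
    rawOf (mkStr C r B hn h) = (n, C.map fun c => (r c, B c)) := by
  refine Prod.ext rfl (List.ext_getElem (by simp [rawOf]) fun i h1 h2 => ?_)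
  have hi : i < C.length := by simpa using h2
  simp only [rawOf, mkStr, List.getElem_ofFn, List.getElem_map, List.get_eq_getElem,
    List.map_map, Fin.val_cast, Prod.mk.injEq, true_and]
  conv_rhs => rw [← List.map_id (B C[i])]
  refine List.map_congr_left fun u hu => ?_
  exact map_val_map_toFin hn (hlt _ (List.getElem_mem hi) u hu)

theorem isPolymorphism_mkStr (hlt : ∀ c ∈ C, ∀ u ∈ B c, ∀ x ∈ u, x < n) {k : ℕ}
    (F : (Fin k → Fin n) → Fin n)
    (hF : ∀ c ∈ C, ∀ u : List (Fin k → Fin n), u.length = r c →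
      (∀ j, u.map (fun a => (a j).val) ∈ B c) → u.map (fun a => (F a).val) ∈ B c) :
    IsPolymorphism (mkStr C r B hn h).toRel F := by
  intro i u hu
  have hc : C.get (i.cast (by simp)) ∈ C := List.get_mem _ _
  refine (map_mem_map_toFin hn (hlt _ hc) F u).2 (hF _ hc u (hu.1.trans (by simp)) fun j => ?_)
  exact (map_mem_map_toFin hn (hlt _ hc) (fun a : Fin k → Fin n => a j) u).1 (hu.2 j)

theorem homTo_mkStr (hltA : ∀ c ∈ C, ∀ u ∈ A c, ∀ x ∈ u, x < N)
    (hlt : ∀ c ∈ C, ∀ u ∈ B c, ∀ x ∈ u, x < n) :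
    (mkStr C r A hN hA).HomTo (mkStr C r B hn h) ↔
      ∃ g : ℕ → ℕ, (∀ j < N, g j < n) ∧ ∀ c ∈ C, ∀ u ∈ A c, u.map g ∈ B c := by
  constructor
  · rintro ⟨(f : Fin N → Fin n), hf⟩
    refine ⟨fun j => (f (toFin hN j)).val, fun j _ => (f _).isLt, ?_⟩
    refine (forall_fin_map_iff (r := r) _).1 fun i u hu => ?_
    have hc : C.get (i.cast (by simp)) ∈ C := List.get_mem _ _
    have : (u.map (toFin hN)).map (fun a => (f a).val) ∈ _ :=
      (map_mem_map_toFin hn (hlt _ hc) f _).1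
        (hf i (u.map (toFin hN)) (List.mem_map_of_mem hu))
    rwa [List.map_map] at this
  · rintro ⟨g, hg, hsol⟩
    refine ⟨fun x : Fin N => toFin hn (g x.val), fun i (u : List (Fin N)) hu => ?_⟩
    have hc : C.get (i.cast (by simp)) ∈ C := List.get_mem _ _
    refine (map_mem_map_toFin hn (hlt _ hc) (fun x : Fin N => toFin hn (g x.val)) u).2 ?_
    have h1 := (mem_map_toFin hN (hltA _ hc) _).1 hu
    have h2 := hsol _ hc _ h1
    rw [List.map_map] at h2
    convert h2 using 1
    exact List.map_congr_left fun x _ => val_toFin hn (hg _ x.isLt)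

end mkStr

section rawOf

variable {τ : List ℕ} {H : FinStr τ}

theorem map_val_mem_iff {ι : Type} {n : ℕ} {l : List (List (Fin n))} (f : ι → Fin n)
    {u : List ι} :
    u.map (fun a => (f a).val) ∈ l.map (fun w => w.map Fin.val) ↔ u.map f ∈ l := by
  rw [← List.mem_map_of_injective (List.map_injective_iff.2 Fin.val_injective), List.map_map]
  rfl

theorem mem_rawOf {ρ : ℕ × List (List ℕ)} : ρ ∈ (rawOf H).2 ↔
    ∃ i, ρ = (τ.get i, (H.tuples i).map fun u => u.map Fin.val) := by
  simp only [rawOf, List.mem_ofFn, eq_comm]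

theorem rawOf_length {ρ : ℕ × List (List ℕ)} (hρ : ρ ∈ (rawOf H).2) {u : List ℕ} (hu : u ∈ ρ.2) :
    u.length = ρ.1 := by
  obtain ⟨i, rfl⟩ := mem_rawOf.1 hρ
  obtain ⟨w, hw, rfl⟩ := List.mem_map.1 hu
  rw [List.length_map]
  exact H.length_eq i w hw

theorem rawOf_lt {ρ : ℕ × List (List ℕ)} (hρ : ρ ∈ (rawOf H).2) {u : List ℕ} (hu : u ∈ ρ.2) :
    ∀ x ∈ u, x < H.size := by
  obtain ⟨i, rfl⟩ := mem_rawOf.1 hρ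
  obtain ⟨w, hw, rfl⟩ := List.mem_map.1 hu
  intro x hx
  obtain ⟨y, _, rfl⟩ := List.mem_map.1 hx
  exact y.isLt

/-- A polymorphism preserves the relations of the data of the structure. -/
theorem IsPolymorphism.map_mem {k : ℕ} {F : (Fin k → Fin H.size) → Fin H.size}
    (hF : IsPolymorphism H.toRel F) {ρ : ℕ × List (List ℕ)} (hρ : ρ ∈ (rawOf H).2)
    {u : List (Fin k → Fin H.size)} (hlen : u.length = ρ.1)
    (hu : ∀ j, u.map (fun a => (a j).val) ∈ ρ.2) : u.map (fun a => (F a).val) ∈ ρ.2 := by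
  obtain ⟨i, rfl⟩ := mem_rawOf.1 hρ
  exact (map_val_mem_iff F).2 (hF i u
    ⟨hlen, fun j => (map_val_mem_iff fun a : Fin k → Fin H.size => a j).1 (hu j)⟩)

theorem isPolymorphism_of_map_mem {k : ℕ} {F : (Fin k → Fin H.size) → Fin H.size}
    (hF : ∀ ρ ∈ (rawOf H).2, ∀ u : List (Fin k → Fin H.size), u.length = ρ.1 →
      (∀ j, u.map (fun a => (a j).val) ∈ ρ.2) → u.map (fun a => (F a).val) ∈ ρ.2) :
    IsPolymorphism H.toRel F := by
  intro i u hu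
  exact (map_val_mem_iff F).1 (hF _ (mem_rawOf.2 ⟨i, rfl⟩) u hu.1 fun j =>
    (map_val_mem_iff fun a : Fin k → Fin H.size => a j).2 (hu.2 j))

end rawOf

/-! ### Solutions of the indicator instance -/

theorem map_getD_range (u : List ℕ) : (List.range u.length).map (fun p => u.getD p 0) = u := by
  refine List.ext_getElem (by simp) fun i h1 h2 => ?_
  simp [List.getElem?_eq_getElem h2]

section points

variable {M : MaltsevCondition} {n : ℕ}

theorem mem_points {e : List ℕ} : e ∈ points M n ↔
    ∃ (i : Fin M.m) (x : Fin (M.ar i) → ℕ), (∀ j, x j < n) ∧ e = point M i x := by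
  simp only [points, List.mem_flatMap, List.mem_finRange, true_and, List.mem_map, mem_tuplesOf,
    List.mem_range]
  constructor
  · rintro ⟨i, x, ⟨h1, h2⟩, rfl⟩
    refine ⟨i, _, fun j => ?_, rfl⟩
    rw [List.getD_eq_getElem _ _ (j.isLt.trans_eq h1.symm)]
    exact h2 _ (List.getElem_mem _)
  · rintro ⟨i, x, hx, rfl⟩
    refine ⟨i, List.ofFn x, ⟨by simp, fun a ha => ?_⟩, ?_⟩
    · obtain ⟨j, rfl⟩ := List.mem_ofFn.1 ha
      exact hx j
    · simp [point]

theorem position_spec {E : List (List ℕ)} {e : List ℕ} (he : e ∈ E) :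
    position E e < E.length ∧ E.getD (position E e) [] = e := by
  have hne : ((List.range E.length).filter fun j => decide (E.getD j [] = e)) ≠ [] := by
    obtain ⟨j, hj, hje⟩ := List.getElem_of_mem he
    refine List.ne_nil_of_mem (a := j) (List.mem_filter.2 ⟨List.mem_range.2 hj, ?_⟩)
    rw [decide_eq_true_eq, List.getD_eq_getElem _ _ hj, hje]
  have hmem : position E e ∈ (List.range E.length).filter fun j => decide (E.getD j [] = e) := by
    unfold position
    cases h : (List.range E.length).filter fun j => decide (E.getD j [] = e) with
    | nil => exact absurd h hne
    | cons a l => simp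
  rw [List.mem_filter, List.mem_range, decide_eq_true_eq] at hmem
  exact hmem

theorem position_lt {i : Fin M.m} {x : Fin (M.ar i) → ℕ} (hx : ∀ j, x j < n) :
    position (points M n) (point M i x) < (points M n).length :=
  (position_spec (mem_points.2 ⟨i, x, hx, rfl⟩)).1

/-- The value of operations at a point. -/
def evalPoint (hn : 0 < n) (F : Ops M.ar (Fin n)) (e : List ℕ) : ℕ :=
  if h : e.headD 0 < M.m then (F ⟨e.headD 0, h⟩ fun j => toFin hn (e.tail.getD j 0)).val else 0

theorem evalPoint_point (hn : 0 < n) (F : Ops M.ar (Fin n)) (i : Fin M.m)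
    (x : Fin (M.ar i) → ℕ) : evalPoint hn F (point M i x) = (F i fun j => toFin hn (x j)).val := by
  simp [evalPoint, point]

theorem evalPoint_lt (hn : 0 < n) (F : Ops M.ar (Fin n)) (e : List ℕ) : evalPoint hn F e < n := by
  unfold evalPoint
  split_ifs
  · exact Fin.isLt _
  · exact hn

end points

/-- The variables of the identities of `M` are less than `V`. -/
def VarsBelow (M : MaltsevCondition) (V : ℕ) : Prop :=
  ∀ e ∈ M.ids, (∀ j, e.args j < V) ∧ match e.rhs with
    | .var y => y < V
    | .app _ xs => ∀ j, xs j < V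

theorem exists_varsBelow (M : MaltsevCondition) : ∃ V, VarsBelow M V := by
  unfold VarsBelow
  induction M.ids with
  | nil => exact ⟨0, by simp⟩
  | cons e l ih =>
    obtain ⟨V, hV⟩ := ih
    obtain ⟨i, xs, y | ⟨i', ys⟩⟩ := e
    · refine ⟨V + (∑ j, xs j) + y + 1, ?_⟩
      simp only [List.forall_mem_cons]
      refine ⟨⟨fun j => ?_, by omega⟩, fun e he => ?_⟩
      · have := Finset.single_le_sum (f := xs) (fun _ _ => Nat.zero_le _) (Finset.mem_univ j)
        omega
      · refine ⟨fun j => ((hV e he).1 j).trans_le (by omega), ?_⟩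
        have := (hV e he).2
        cases hr : e.rhs with
        | var y => rw [hr] at this; exact Nat.lt_of_lt_of_le this (by omega)
        | app f xs => rw [hr] at this; exact fun j => (this j).trans_le (by omega)
    · refine ⟨V + (∑ j, xs j) + (∑ j, ys j) + 1, ?_⟩
      simp only [List.forall_mem_cons]
      refine ⟨⟨fun j => ?_, fun j => ?_⟩, fun e he => ?_⟩
      · have := Finset.single_le_sum (f := xs) (fun _ _ => Nat.zero_le _) (Finset.mem_univ j)
        omega
      · have := Finset.single_le_sum (f := ys) (fun _ _ => Nat.zero_le _) (Finset.mem_univ j)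
        omega
      · refine ⟨fun j => ((hV e he).1 j).trans_le (by omega), ?_⟩
        have := (hV e he).2
        cases hr : e.rhs with
        | var y => rw [hr] at this; exact Nat.lt_of_lt_of_le this (by omega)
        | app f xs => rw [hr] at this; exact fun j => (this j).trans_le (by omega)

/-- `g` assigns values less than `n` to `0, …, N - 1` and satisfies the constraints `C`. -/
def IsSolution (N n : ℕ) (C : List Constraint) (g : ℕ → ℕ) : Prop :=
  (∀ j < N, g j < n) ∧ ∀ c ∈ C, ∀ u ∈ c.2.1, u.map g ∈ c.2.2

/-- The pins are pairs of an element below `N` and a value below `n`. -/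
def PinsBelow (N n : ℕ) (pins : List (ℕ × ℕ)) : Prop := ∀ q ∈ pins, q.1 < N ∧ q.2 < n

/-- `g` takes the pinned values. -/
def Agrees (g : ℕ → ℕ) (pins : List (ℕ × ℕ)) : Prop := ∀ q ∈ pins, g q.1 = q.2

theorem isSolution_pinned_iff {M : MaltsevCondition} {V N : ℕ} {R : RawStr}
    {pins : List (ℕ × ℕ)} (hp : PinsBelow N R.1 pins) {g : ℕ → ℕ} :
    IsSolution N R.1 (pinned M V R pins) g ↔
      IsSolution N R.1 (indicator M V R) g ∧ Agrees g pins := by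
  simp only [IsSolution, pinned, List.forall_mem_append, ← and_assoc]
  refine and_congr_right fun _ => ?_
  simp only [pinConstraints, List.forall_mem_map, List.mem_range, List.mem_filter,
    decide_eq_true_eq, List.map_cons, List.map_nil, List.mem_singleton, List.cons.injEq, and_true,
    and_imp]
  constructor
  · exact fun h q hq => h q.2 (hp q hq).2 q hq rfl
  · rintro h a _ q hq rfl
    exact h q hq

section indicator

variable {M : MaltsevCondition} {V : ℕ} {τ : List ℕ} {H : FinStr τ}

theorem getD_lt_of_mem_tuplesOf {n : ℕ} (hn : 0 < n) {v : List ℕ}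
    (hv : v ∈ tuplesOf (List.range n) V) (x : ℕ) : v.getD x 0 < n := by
  rw [mem_tuplesOf] at hv
  by_cases hx : x < v.length
  · rw [List.getD_eq_getElem _ _ hx]
    exact List.mem_range.1 (hv.2 _ (List.getElem_mem _))
  · rw [List.getD_eq_default _ _ (by omega)]
    exact hn

theorem row_lt {i : Fin M.m} {ρ : ℕ × List (List ℕ)} (hρ : ρ ∈ (rawOf H).2) {us : List (List ℕ)}
    (hus : us ∈ tuplesOf ρ.2 (M.ar i)) {p : ℕ} (hp : p < ρ.1) (j : Fin (M.ar i)) :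
    (us.getD j []).getD p 0 < H.size := by
  rw [mem_tuplesOf] at hus
  have hj : j.val < us.length := j.isLt.trans_eq hus.1.symm
  rw [List.getD_eq_getElem _ _ hj]
  have hmem := hus.2 _ (List.getElem_mem hj)
  rw [List.getD_eq_getElem _ _ (by rw [rawOf_length hρ hmem]; exact hp)]
  exact rawOf_lt hρ hmem _ (List.getElem_mem _)

theorem pinsBelow_identityPins {n : ℕ} (hn : 0 < n) :
    PinsBelow (points M n).length n (identityPins M V n (points M n)) := by
  intro q hq
  simp only [identityPins, List.mem_flatMap] at hq
  obtain ⟨e, -, hq⟩ := hq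
  split at hq
  · obtain ⟨v, hv, rfl⟩ := List.mem_map.1 hq
    exact ⟨position_lt fun j => getD_lt_of_mem_tuplesOf hn hv _, getD_lt_of_mem_tuplesOf hn hv _⟩
  · simp at hq

/-- The relations of the pinned indicator instance have tuples of the right lengths and with
entries in the universes. -/
theorem pinned_valid {pins : List (ℕ × ℕ)}
    (hp : PinsBelow (points M H.size).length H.size pins) :
    ∀ c ∈ pinned M V (rawOf H) pins,
      (∀ u ∈ c.2.1, u.length = c.1 ∧ ∀ x ∈ u, x < (points M H.size).length) ∧
      (∀ u ∈ c.2.2, u.length = c.1 ∧ ∀ x ∈ u, x < H.size) := by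
  have hH : (rawOf H).1 = H.size := rfl
  simp only [pinned, indicator, pinConstraints, hH, List.mem_append, List.mem_cons]
  rintro c ((rfl | hc) | hc)
  · refine ⟨fun u hu => ?_, fun u hu => ?_⟩
    · simp only [equalPairs, List.mem_flatMap] at hu
      obtain ⟨e, -, hu⟩ := hu
      split at hu
      · simp at hu
      · obtain ⟨v, hv, rfl⟩ := List.mem_map.1 hu
        simp only [List.length_cons, List.length_nil, List.mem_cons, List.not_mem_nil, or_false]
        refine ⟨trivial, ?_⟩
        rintro x (rfl | rfl) <;>
          exact position_lt fun j => getD_lt_of_mem_tuplesOf H.size_pos hv _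
    · obtain ⟨a, ha, rfl⟩ := List.mem_map.1 hu
      simpa using ha
  · obtain ⟨ρ, hρ, rfl⟩ := List.mem_map.1 hc
    refine ⟨fun u hu => ?_, fun u hu => ⟨rawOf_length hρ hu, rawOf_lt hρ hu⟩⟩
    simp only [liftTuples, List.mem_flatMap] at hu
    obtain ⟨i, -, hu⟩ := hu
    obtain ⟨us, hus, rfl⟩ := List.mem_map.1 hu
    refine ⟨by simp, fun x hx => ?_⟩
    obtain ⟨p, hpr, rfl⟩ := List.mem_map.1 hx
    exact position_lt fun j => row_lt hρ hus (List.mem_range.1 hpr) j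
  · obtain ⟨a, ha, rfl⟩ := List.mem_map.1 hc
    refine ⟨fun u hu => ?_, fun u hu => ?_⟩
    · obtain ⟨q, hq, rfl⟩ := List.mem_map.1 hu
      simpa using (hp q (List.mem_of_mem_filter hq)).1
    · rw [List.mem_singleton] at hu
      subst hu
      simpa using ha

/-- Polymorphisms that satisfy the condition are a solution of the indicator instance. -/
theorem MaltsevCondition.PolymorphismsOf.exists_solution {F : Ops M.ar (Fin H.size)}
    (hF : M.PolymorphismsOf H F) :
    ∃ g, IsSolution (points M H.size).length H.size (indicator M V (rawOf H)) g ∧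
      Agrees g (identityPins M V H.size (points M H.size)) := by
  have hH : (rawOf H).1 = H.size := rfl
  have hn := H.size_pos
  refine ⟨fun j => evalPoint hn F ((points M H.size).getD j []), ⟨fun j _ => evalPoint_lt hn F _,
    ?_⟩, ?_⟩
  · have key : ∀ (i : Fin M.m) (x : Fin (M.ar i) → ℕ), (∀ j, x j < H.size) →
        evalPoint hn F ((points M H.size).getD (position (points M H.size) (point M i x)) []) =
          (F i fun j => toFin hn (x j)).val := fun i x hx => by
      rw [(position_spec (mem_points.2 ⟨i, x, hx, rfl⟩)).2, evalPoint_point]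
    simp only [indicator, hH, List.mem_cons]
    rintro c (rfl | hc) u hu
    · simp only [equalPairs, List.mem_flatMap] at hu
      obtain ⟨e, he, hu⟩ := hu
      have hid := hF.2 e he
      split at hu
      · simp at hu
      · rename_i f xs hrhs
        obtain ⟨v, hv, rfl⟩ := List.mem_map.1 hu
        have hlt := getD_lt_of_mem_tuplesOf hn hv
        have := hid fun x => toFin hn (v.getD x 0)
        rw [hrhs] at this
        simp only [LinTerm.eval] at this
        simp only [List.map_cons, List.map_nil, key _ _ fun j => hlt _, this]
        exact List.mem_map.2 ⟨_, List.mem_range.2 (Fin.isLt _), rfl⟩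
    · obtain ⟨ρ, hρ, rfl⟩ := List.mem_map.1 hc
      simp only [liftTuples, List.mem_flatMap] at hu
      obtain ⟨i, -, hu⟩ := hu
      obtain ⟨us, hus, rfl⟩ := List.mem_map.1 hu
      have := (hF.1 i).map_mem hρ (u := (List.range ρ.1).map fun p => fun j =>
        toFin hn ((us.getD j []).getD p 0)) (by simp) fun j => by
          have hus' := mem_tuplesOf.1 hus
          have hj : j.val < us.length := j.isLt.trans_eq hus'.1.symm
          have hmem := hus'.2 _ (List.getElem_mem hj)
          rw [List.map_map]
          convert hmem using 1
          conv_rhs => rw [← map_getD_range us[j.val], rawOf_length hρ hmem]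
          refine List.map_congr_left fun p hp => ?_
          rw [← List.getD_eq_getElem _ [] hj]
          exact val_toFin hn (row_lt hρ hus (List.mem_range.1 hp) j)
      rw [List.map_map] at this ⊢
      convert this using 1
      refine List.map_congr_left fun p hp => ?_
      exact key i _ fun j => row_lt hρ hus (List.mem_range.1 hp) j
  · intro q hq
    simp only [identityPins, List.mem_flatMap] at hq
    obtain ⟨e, he, hq⟩ := hq
    have hid := hF.2 e he
    split at hq
    · rename_i y hrhs
      obtain ⟨v, hv, rfl⟩ := List.mem_map.1 hq
      have hlt := getD_lt_of_mem_tuplesOf hn hv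
      have := hid fun x => toFin hn (v.getD x 0)
      rw [hrhs] at this
      simp only [LinTerm.eval] at this
      simp only
      rw [(position_spec (mem_points.2 ⟨_, _, fun j => hlt _, rfl⟩)).2, evalPoint_point, this,
        val_toFin hn (hlt y)]
    · simp at hq

/-- The operations that a solution of the indicator instance describes. -/
def opsOf (M : MaltsevCondition) {n : ℕ} (hn : 0 < n) (g : ℕ → ℕ) : Ops M.ar (Fin n) :=
  fun i x => toFin hn (g (position (points M n) (point M i fun j => (x j).val)))

/-- A solution of the indicator instance describes polymorphisms that satisfy the condition. -/
theorem polymorphismsOf_opsOf (hV : VarsBelow M V) {g : ℕ → ℕ}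
    (hg : IsSolution (points M H.size).length H.size (indicator M V (rawOf H)) g)
    (hpins : Agrees g (identityPins M V H.size (points M H.size))) :
    M.PolymorphismsOf H (opsOf M H.size_pos g) := by
  have hH : (rawOf H).1 = H.size := rfl
  have hn := H.size_pos
  have hval : ∀ i x, (opsOf M hn g i x).val =
      g (position (points M H.size) (point M i fun j => (x j).val)) := fun i x =>
    val_toFin hn (hg.1 _ (position_lt fun j => (x j).isLt))
  have hsol := hg.2
  simp only [indicator, hH, List.forall_mem_cons, List.forall_mem_map] at hsol
  refine ⟨fun i => isPolymorphism_of_map_mem fun ρ hρ u hlen hu => ?_, fun e he v => ?_⟩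
  · have hus : List.ofFn (fun j => u.map fun a => (a j).val) ∈ tuplesOf ρ.2 (M.ar i) := by
      refine mem_tuplesOf.2 ⟨by simp, fun w hw => ?_⟩
      obtain ⟨j, rfl⟩ := List.mem_ofFn.1 hw
      exact hu j
    have := hsol.2 ρ hρ _ (List.mem_flatMap.2
      ⟨i, List.mem_finRange i, List.mem_map.2 ⟨_, hus, rfl⟩⟩)
    convert this using 1
    refine List.ext_getElem (by simp [hlen]) fun p h1 h2 => ?_
    have hp : p < u.length := by simpa using h1
    simp only [List.getElem_map, List.getElem_range]
    rw [hval]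
    congr 3
    funext j
    rw [List.getD_eq_getElem (List.ofFn _) _ (by simp), List.getElem_ofFn,
      List.getD_eq_getElem _ _ (by rwa [List.length_map]), List.getElem_map]
  · -- the list of the values of the variables that occur in the identities
    have hv : (List.range V).map (fun x => (v x).val) ∈ tuplesOf (List.range H.size) V := by
      refine mem_tuplesOf.2 ⟨by simp, fun a ha => ?_⟩
      obtain ⟨x, -, rfl⟩ := List.mem_map.1 ha
      exact List.mem_range.2 (v x).isLt
    have hget : ∀ x < V, ((List.range V).map fun x => (v x).val).getD x 0 = (v x).val := by
      intro x hx
      rw [List.getD_eq_getElem _ _ (by simpa using hx)]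
      simp
    obtain ⟨hV1, hV2⟩ := hV e he
    refine Fin.ext ?_
    rw [hval]
    cases hrhs : e.rhs with
    | var y =>
      rw [hrhs] at hV2
      have := hpins (position (points M H.size) (point M e.sym fun j =>
        ((List.range V).map fun x => (v x).val).getD (e.args j) 0),
        ((List.range V).map fun x => (v x).val).getD y 0)
        (List.mem_flatMap.2 ⟨e, he, by rw [hrhs]; exact List.mem_map.2 ⟨_, hv, rfl⟩⟩)
      simp only [hget _ (hV1 _), hget y hV2] at this
      exact this
    | app f xs =>
      rw [hrhs] at hV2
      have := hsol.1 _ (List.mem_flatMap.2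
        ⟨e, he, by rw [hrhs]; exact List.mem_map.2 ⟨_, hv, rfl⟩⟩)
      simp only [hget _ (hV1 _), hget _ (hV2 _), List.map_cons, List.map_nil, List.mem_map,
        List.cons.injEq, and_true] at this
      obtain ⟨a, -, h1, h2⟩ := this
      rw [← h1, h2]
      exact (hval f _).symm

/-- Idempotent polymorphisms also preserve equality and the constants. -/
theorem MaltsevCondition.PolymorphismsOf.mkStr_pinned (hM : M.IsIdempotent)
    {F : Ops M.ar (Fin H.size)} (hF : M.PolymorphismsOf H F) {pins : List (ℕ × ℕ)}
    (hlen : ∀ c ∈ pinned M V (rawOf H) pins, ∀ u ∈ c.2.2, u.length = c.1)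
    (hlt : ∀ c ∈ pinned M V (rawOf H) pins, ∀ u ∈ c.2.2, ∀ x ∈ u, x < H.size) :
    M.PolymorphismsOf (mkStr (pinned M V (rawOf H) pins) (fun c => c.1) (fun c => c.2.2)
      H.size_pos hlen) F := by
  have hH : (rawOf H).1 = H.size := rfl
  refine ⟨fun i => isPolymorphism_mkStr hlt _ fun c hc u hu hmem => ?_, hF.2⟩
  -- there is at least one coordinate, as the arity is positive
  obtain ⟨j₀⟩ : Nonempty (Fin (M.ar i)) := ⟨⟨0, M.ar_pos i⟩⟩
  simp only [pinned, indicator, pinConstraints, hH, List.mem_append, List.mem_cons] at hc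
  rcases hc with (rfl | hc) | hc
  · match u, hu with
    | [a, b], _ =>
      have hab : a = b := by
        funext j
        obtain ⟨x, -, hx⟩ := List.mem_map.1 (hmem j)
        simp only [List.map_cons, List.map_nil, List.cons.injEq, and_true] at hx
        exact Fin.ext (hx.1.symm.trans hx.2)
      subst hab
      exact List.mem_map.2 ⟨_, List.mem_range.2 (Fin.isLt _), rfl⟩
  · obtain ⟨ρ, hρ, rfl⟩ := List.mem_map.1 hc
    exact (hF.1 i).map_mem hρ hu hmem
  · obtain ⟨x, hx, rfl⟩ := List.mem_map.1 hc
    match u, hu with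
    | [a], _ =>
      simp only [List.map_cons, List.map_nil, List.mem_singleton, List.cons.injEq, and_true]
        at hmem ⊢
      have ha : a = fun _ => a j₀ := funext fun j => Fin.ext ((hmem j).trans (hmem j₀).symm)
      have := hM i (Fin H.size) F hF.2 fun _ => a j₀
      simp only [LinTerm.eval] at this
      rw [ha, this]
      exact hmem j₀

end indicator

/-! ### Correctness of the search -/

theorem map_allTuples (n k : ℕ) :
    (allTuples n k).map (fun x => List.ofFn fun j => (x j).val) = tuplesOf (List.range n) k := by
  induction k with
  | zero => simp [allTuples, tuplesOf]
  | succ k ih =>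
    rw [allTuples, tuplesOf, ← ih, ← List.map_coe_finRange_eq_range, List.map_flatMap,
      List.flatMap_map]
    simp [Function.comp_def, List.ofFn_succ]

/-- Operations have the tables that the algorithm writes if their values are the pinned ones. -/
theorem enc_opTables {M : MaltsevCondition} {n : ℕ} {pins : List (ℕ × ℕ)}
    {F : Ops M.ar (Fin n)} (hF : ∀ i x, (F i x).val =
      pinValue pins (position (points M n) (point M i fun j => (x j).val))) :
    enc (opTables M n pins) = encOps F := by
  change encList ((opTables M n pins).map fun l => encList (l.map encNat)) = _
  rw [opTables, encOps, List.map_map, List.ofFn_eq_map]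
  congr 1
  refine List.map_congr_left fun i _ => ?_
  rw [Function.comp_apply, encOp, ← map_allTuples, List.map_map, List.map_map]
  congr 1
  refine List.map_congr_left fun x _ => ?_
  simp [hF]

section search

variable {M : MaltsevCondition} {V : ℕ} {τ : List ℕ} {H : FinStr τ}
  {f : BinaryTree Unit → BinaryTree Unit}

/-- If `H` satisfies the condition, then the pinned indicator instance is within the promise of the
uniform algorithm, whose answer is therefore right. -/
theorem extendable_iff (hM : M.IsIdempotent)
    (hf : ∀ (τ : List ℕ) (G H : FinStr τ), M.HoldsIn H →
      IsAnswer (f (encPair (encStr G) (encStr H))) (G.HomTo H))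
    (hm : 0 < M.m) (hH : M.HoldsIn H) {pins : List (ℕ × ℕ)}
    (hp : PinsBelow (points M H.size).length H.size pins) :
    extendable f M V (rawOf H) pins = true ↔
      ∃ g, IsSolution (points M H.size).length H.size (pinned M V (rawOf H) pins) g := by
  have hn := H.size_pos
  have hN : 0 < (points M H.size).length := List.length_pos_of_mem
    (mem_points.2 ⟨⟨0, hm⟩, fun _ => 0, fun _ => hn, rfl⟩)
  have hval := pinned_valid (V := V) hp
  have hA : ∀ c ∈ pinned M V (rawOf H) pins, ∀ u ∈ c.2.1, u.length = c.1 :=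
    fun c hc u hu => ((hval c hc).1 u hu).1
  have hB : ∀ c ∈ pinned M V (rawOf H) pins, ∀ u ∈ c.2.2, u.length = c.1 :=
    fun c hc u hu => ((hval c hc).2 u hu).1
  have hltA : ∀ c ∈ pinned M V (rawOf H) pins, ∀ u ∈ c.2.1, ∀ x ∈ u,
      x < (points M H.size).length := fun c hc u hu => ((hval c hc).1 u hu).2
  have hltB : ∀ c ∈ pinned M V (rawOf H) pins, ∀ u ∈ c.2.2, ∀ x ∈ u, x < H.size :=
    fun c hc u hu => ((hval c hc).2 u hu).2
  obtain ⟨F, hF⟩ := hH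
  have key := hf _ (mkStr (pinned M V (rawOf H) pins) (fun c => c.1) (fun c => c.2.1) hN hA)
    (mkStr (pinned M V (rawOf H) pins) (fun c => c.1) (fun c => c.2.2) hn hB)
    ⟨F, hF.mkStr_pinned hM hB hltB⟩
  rw [homTo_mkStr hltA hltB, ← enc_rawOf, ← enc_rawOf, rawOf_mkStr hltA, rawOf_mkStr hltB] at key
  have hext : extendable f M V (rawOf H) pins = !(treeToList (f (encPair
      (enc ((points M H.size).length, (pinned M V (rawOf H) pins).map fun c => (c.1, c.2.1)))
      (enc (H.size, (pinned M V (rawOf H) pins).map fun c => (c.1, c.2.2)))))).isEmpty := rfl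
  rw [hext]
  by_cases hsol : ∃ g, IsSolution (points M H.size).length H.size (pinned M V (rawOf H) pins) g
  · rw [key.1 hsol]
    simp [yes, treeToList, hsol]
  · rw [key.2 hsol]
    simp [no, treeToList, hsol]

theorem PinsBelow.pinStep {N : ℕ} {R : RawStr} (hn : 0 < R.1) {pins : List (ℕ × ℕ)}
    (hp : PinsBelow N R.1 pins) {j : ℕ} (hj : j < N) :
    PinsBelow N R.1 (pinStep f M V R pins j) := by
  refine List.forall_mem_cons.2 ⟨⟨hj, ?_⟩, hp⟩
  cases h : (List.range R.1).filter fun a => extendable f M V R ((j, a) :: pins) with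
  | nil => exact hn
  | cons a l =>
    have : a ∈ (List.range R.1).filter fun a => extendable f M V R ((j, a) :: pins) := by
      rw [h]; simp
    exact List.mem_range.1 (List.mem_of_mem_filter this)

/-- Whatever the algorithm answers, the search keeps the pins that it started with, and pins each of
its points to an element of the universe. -/
theorem foldl_pinStep {N : ℕ} {R : RawStr} (hn : 0 < R.1) (l : List ℕ) (hl : ∀ j ∈ l, j < N)
    (pins : List (ℕ × ℕ)) (hp : PinsBelow N R.1 pins) :
    PinsBelow N R.1 (l.foldl (pinStep f M V R) pins) ∧
      pins ⊆ l.foldl (pinStep f M V R) pins ∧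
      ∀ j ∈ l, ∃ a, (j, a) ∈ l.foldl (pinStep f M V R) pins := by
  induction l generalizing pins with
  | nil => exact ⟨hp, List.Subset.refl _, by simp⟩
  | cons j l ih =>
    rw [List.forall_mem_cons] at hl
    obtain ⟨h1, h2, h3⟩ := ih hl.2 (pinStep f M V R pins j) (hp.pinStep hn hl.1)
    refine ⟨h1, fun q hq => h2 (List.mem_cons_of_mem _ hq), List.forall_mem_cons.2 ⟨?_, h3⟩⟩
    exact ⟨_, h2 List.mem_cons_self⟩

/-- If the answers are right, the search maintains that some solution agrees with all pins. -/
theorem exists_agrees_foldl_pinStep {N : ℕ} {R : RawStr} (hn : 0 < R.1)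
    (hext : ∀ pins, PinsBelow N R.1 pins →
      (extendable f M V R pins = true ↔ ∃ g, IsSolution N R.1 (pinned M V R pins) g))
    (l : List ℕ) (hl : ∀ j ∈ l, j < N) (pins : List (ℕ × ℕ)) (hp : PinsBelow N R.1 pins)
    (hg : ∃ g, IsSolution N R.1 (indicator M V R) g ∧ Agrees g pins) :
    ∃ g, IsSolution N R.1 (indicator M V R) g ∧ Agrees g (l.foldl (pinStep f M V R) pins) := by
  induction l generalizing pins with
  | nil => exact hg
  | cons j l ih =>
    rw [List.forall_mem_cons] at hl
    refine ih hl.2 (pinStep f M V R pins j) (hp.pinStep hn hl.1) ?_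
    obtain ⟨g, hsol, hag⟩ := hg
    have hbelow : ∀ a, a < R.1 → PinsBelow N R.1 ((j, a) :: pins) := fun a ha =>
      List.forall_mem_cons.2 ⟨⟨hl.1, ha⟩, hp⟩
    -- the value of `g` at `j` is one that the algorithm accepts
    have hmem : g j ∈ (List.range R.1).filter fun a => extendable f M V R ((j, a) :: pins) := by
      have hlt := hsol.1 j hl.1
      rw [List.mem_filter, List.mem_range]
      refine ⟨hlt, (hext _ (hbelow _ hlt)).2 ⟨g, (isSolution_pinned_iff (hbelow _ hlt)).2
        ⟨hsol, List.forall_mem_cons.2 ⟨rfl, hag⟩⟩⟩⟩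
    unfold pinStep
    cases h : (List.range R.1).filter fun a => extendable f M V R ((j, a) :: pins) with
    | nil => rw [h] at hmem; simp at hmem
    | cons a l' =>
      have ha : a ∈ (List.range R.1).filter fun a => extendable f M V R ((j, a) :: pins) := by
        rw [h]; simp
      rw [List.mem_filter, List.mem_range] at ha
      obtain ⟨g', hg'⟩ := (hext _ (hbelow a ha.1)).1 ha.2
      exact ⟨g', (isSolution_pinned_iff (hbelow a ha.1)).1 hg'⟩

theorem pinValue_eq {pins : List (ℕ × ℕ)} {g : ℕ → ℕ} (hg : Agrees g pins) {j : ℕ}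
    (hj : ∃ a, (j, a) ∈ pins) : pinValue pins j = g j := by
  obtain ⟨a, ha⟩ := hj
  unfold pinValue
  cases h : pins.filter fun q => decide (q.1 = j) with
  | nil =>
    have : (j, a) ∈ pins.filter fun q => decide (q.1 = j) :=
      List.mem_filter.2 ⟨ha, decide_eq_true rfl⟩
    rw [h] at this
    simp at this
  | cons q l =>
    have hq : q ∈ pins.filter fun q => decide (q.1 = j) := by rw [h]; simp
    rw [List.mem_filter, decide_eq_true_eq] at hq
    rw [List.map_cons, List.headD_cons, ← hg q hq.1, hq.2]

theorem pinValue_lt {N n : ℕ} (hn : 0 < n) {pins : List (ℕ × ℕ)} (hp : PinsBelow N n pins)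
    (j : ℕ) : pinValue pins j < n := by
  unfold pinValue
  cases h : pins.filter fun q => decide (q.1 = j) with
  | nil => exact hn
  | cons q l =>
    have hq : q ∈ pins.filter fun q => decide (q.1 = j) := by rw [h]; simp
    exact (hp q (List.mem_of_mem_filter hq)).2

theorem solves_iff {C : List Constraint} {pins : List (ℕ × ℕ)} :
    solves C pins = true ↔ ∀ c ∈ C, ∀ u ∈ c.2.1, u.map (pinValue pins) ∈ c.2.2 := by
  simp [solves]

theorem createOps_correct (hM : M.IsIdempotent) (hV : VarsBelow M V)
    (hf : ∀ (τ : List ℕ) (G H : FinStr τ), M.HoldsIn H →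
      IsAnswer (f (encPair (encStr G) (encStr H))) (G.HomTo H))
    (hm : 0 < M.m) :
    (M.HoldsIn H → ∃ F : Ops M.ar (Fin H.size),
      M.PolymorphismsOf H F ∧ createOps f M V (rawOf H) = found (encOps F)) ∧
    (¬ M.HoldsIn H → createOps f M V (rawOf H) = no) := by
  have hn := H.size_pos
  obtain ⟨P, hP⟩ : ∃ P, P = searchPins f M V (rawOf H) := ⟨_, rfl⟩
  have hrange : ∀ j ∈ List.range (points M H.size).length, j < (points M H.size).length :=
    fun j hj => List.mem_range.1 hj
  obtain ⟨hbelow, hsub, hall⟩ : PinsBelow (points M H.size).length H.size P ∧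
      identityPins M V H.size (points M H.size) ⊆ P ∧
      ∀ j ∈ List.range (points M H.size).length, ∃ a, (j, a) ∈ P := by
    rw [hP]
    exact foldl_pinStep (R := rawOf H) hn _ hrange _ (pinsBelow_identityPins hn)
  -- whatever the algorithm answered, values that pass the test describe suitable operations
  have hsound : solves (pinned M V (rawOf H) P) P = true → ∃ F : Ops M.ar (Fin H.size),
      M.PolymorphismsOf H F ∧ found (enc (opTables M H.size P)) = found (encOps F) := by
    intro hs
    have hsol : IsSolution (points M H.size).length H.size (pinned M V (rawOf H) P) (pinValue P) :=
      ⟨fun j _ => pinValue_lt hn hbelow j, solves_iff.1 hs⟩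
    obtain ⟨hsol, hag⟩ := (isSolution_pinned_iff (R := rawOf H) hbelow).1 hsol
    refine ⟨opsOf M hn (pinValue P), polymorphismsOf_opsOf hV hsol fun q hq => hag q (hsub hq), ?_⟩
    rw [enc_opTables]
    exact fun i x => val_toFin hn (pinValue_lt hn hbelow _)
  have hdef : createOps f M V (rawOf H) = if solves (pinned M V (rawOf H) P) P then
      found (enc (opTables M H.size P)) else no := by rw [hP]; rfl
  rw [hdef]
  refine ⟨fun hH => ?_, fun hH => ?_⟩
  · have hs : solves (pinned M V (rawOf H) P) P = true := by
      obtain ⟨g, hsol, hag⟩ : ∃ g, IsSolution (points M H.size).length H.size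
          (indicator M V (rawOf H)) g ∧ Agrees g P := by
        rw [hP]
        refine exists_agrees_foldl_pinStep (R := rawOf H) hn
          (fun pins hp => extendable_iff hM hf hm hH hp) _ hrange _ (pinsBelow_identityPins hn) ?_
        obtain ⟨F, hF⟩ := hH
        exact hF.exists_solution
      have hpin := (isSolution_pinned_iff (R := rawOf H) hbelow).2 ⟨hsol, hag⟩
      refine solves_iff.2 fun c hc u hu => ?_
      have : u.map (pinValue P) = u.map g := List.map_congr_left fun j hj =>
        pinValue_eq hag (hall j (List.mem_range.2 (((pinned_valid hbelow c hc).1 u hu).2 j hj)))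
      rw [this]
      exact hpin.2 c hc u hu
    rw [if_pos hs]
    exact hsound hs
  · rw [if_neg]
    intro hs
    obtain ⟨F, hF, -⟩ := hsound hs
    exact hH ⟨F, hF⟩

end search

/-! ### The equivalence -/

theorem creationMetaquestionPolyTime_of_uniform {M : MaltsevCondition} (hM : M.IsIdempotent)
    (h : HasUniformAlgorithm M) : CreationMetaquestionPolyTime M := by
  obtain ⟨f, hf, hcorrect⟩ := h
  rcases Nat.eq_zero_or_pos M.m with hm | hm
  · -- without operation symbols there is nothing to find
    have : IsEmpty (Fin M.m) := by rw [hm]; infer_instance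
    have hids : M.ids = [] := List.eq_nil_iff_forall_not_mem.2 fun e _ => isEmptyElim e.sym
    have hpoly : ∀ {τ : List ℕ} (H : FinStr τ) (F : Ops M.ar (Fin H.size)),
        M.PolymorphismsOf H F := fun H F =>
      ⟨fun i => isEmptyElim i, by simp [MaltsevCondition.SatisfiedBy, hids]⟩
    refine ⟨fun _ => found .nil, (PolyFun.const _).polyTime, fun τ H => ⟨fun _ =>
      ⟨fun i => isEmptyElim i, hpoly H _, ?_⟩, fun hH => absurd ⟨fun i => isEmptyElim i,
        hpoly H _⟩ hH⟩⟩
    have : ∀ l : List (Fin M.m), l = [] := fun l =>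
      List.eq_nil_iff_forall_not_mem.2 fun i _ => isEmptyElim i
    rw [encOps, List.ofFn_eq_map, this (List.finRange M.m)]
    rfl
  · obtain ⟨V, hV⟩ := exists_varsBelow M
    refine ⟨fun t => createOps f M V (treeToRaw t),
      ((PolyFun.createOps hf.polyFun M V).comp PolyFun.treeToRaw).polyTime, fun τ H => ?_⟩
    simp only [treeToRaw_encStr]
    exact createOps_correct hM hV hcorrect hm

theorem hasSemiuniformAlgorithm_of_uniform {M : MaltsevCondition}
    (h : HasUniformAlgorithm M) : HasSemiuniformAlgorithm M := by
  obtain ⟨f, hf, hcorrect⟩ := h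
  have := hf.polyFun
  exact ⟨fun t => f t.left, (show PolyFun fun t => f t.left by fun_prop).polyTime,
    fun τ G H F hF => hcorrect τ G H ⟨F, hF⟩⟩

theorem hasUniformAlgorithm_of_creation {M : MaltsevCondition}
    (hc : CreationMetaquestionPolyTime M) (hs : HasSemiuniformAlgorithm M) :
    HasUniformAlgorithm M := by
  obtain ⟨c, hc, hcc⟩ := hc
  obtain ⟨f, hf, hfc⟩ := hs
  have := hc.polyFun
  have := hf.polyFun
  refine ⟨fun t => f (.node () t (c t.right).right),
    (show PolyFun fun t => f (.node () t (c t.right).right) by fun_prop).polyTime,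
    fun τ G H hH => ?_⟩
  obtain ⟨F, hF, hcF⟩ := (hcc τ H).1 hH
  have := hfc τ G H F hF
  simp only [encPair, BinaryTree.right, hcF, found] at this ⊢
  exact this

end CSPMeta

theorem mainTheorem8 (M : CSPMeta.MaltsevCondition) :
    (CSPMeta.CreationMetaquestionPolyTime M ∧ CSPMeta.HasSemiuniformAlgorithm M →
      CSPMeta.HasUniformAlgorithm M) ∧
    (M.IsIdempotent → CSPMeta.HasUniformAlgorithm M →
      CSPMeta.CreationMetaquestionPolyTime M ∧ CSPMeta.HasSemiuniformAlgorithm M) :=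
  ⟨fun h => CSPMeta.hasUniformAlgorithm_of_creation h.1 h.2, fun hM h =>
    ⟨CSPMeta.creationMetaquestionPolyTime_of_uniform hM h,
      CSPMeta.hasSemiuniformAlgorithm_of_uniform h⟩⟩
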